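/- Let $(\Omega,\mathcal F,\mathbb P)$ be a complete probability space, let $\mathcal U$ and $X$ be real separable Hilbert spaces, and let $\dot W=\{\dot W(h),\,h\in\mathcal U\}$ be a zero-mean Gaussian family on $\Omega$ with $\mathbb E(\dot W(h_1)\dot W(h_2))=(h_1,h_2)_{\mathcal U}$ such that, up to $\mathbb P$-null sets, $\mathcal F$ is the $\sigma$-algebra generated by $\dot W$. Let $\mathbf D$ be the Malliavin derivative, i.e. the closure, as an operator from $L_2(\Omega)$ to $L_2(\Omega;\mathcal U)$, of the operator $F(\dot W(h_1),\dots,\dot W(h_N))\mapsto\sum_{i}\frac{\partial F}{\partial x_i}(\dot W(h_1),\dots,\dot W(h_N))\,h_i$, where $F$ is smooth and $F$ and all its partial derivatives have at most polynomial growth. For a real Hilbert space $Y$, the Skorokhod integral $\boldsymbol\delta(f)$ of $f\in L_2(\Omega;Y\otimes\mathcal U)$ is the unique element of $L_2(\Omega;Y)$, if there is one, such that $\mathbb E(\varphi\,\boldsymbol\delta(f))=\mathbb E\,(f,\mathbf D\varphi)_{\mathcal U}$ in $Y$ for all $\varphi$ in the domain of $\mathbf D$. For $k\ge1$ let $\mathcal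 U^{\hat\otimes k}\subset\mathcal U^{\otimes k}$ be the symmetric tensor power with the norm of the Hilbert tensor product $\mathcal U^{\otimes k}$, and let $\boldsymbol\delta^{\hat\otimes k}$ be the $k$-fold iterate of $\boldsymbol\delta$, from elements of $L_2(\Omega;X\otimes\mathcal U^{\hat\otimes k})$ to elements of $L_2(\Omega;X)$, where each step integrates out the last factor $\mathcal U$. Then for every $\eta\in L_2(\Omega;X)$ there is a unique collection of deterministic elements $\eta_0\in X$ and $\eta_k\in X\otimes\mathcal U^{\hat\otimes k}$, $k\ge1$, such that each $\boldsymbol\delta^{\hat\otimes k}(\eta_k)$ is defined and $$\eta=\eta_0+\sum_{k\ge1}\frac1{k!}\,\boldsymbol\delta^{\hat\otimes k}(\eta_k),$$ where the series converges unconditionally in $L_2(\Omega;X)$. Moreover, $\eta_0=\mathbb E\eta$ and $$\mathbb E\|\eta\|_X^2=\|\eta_0\|_X^2+\sum_{k\ge1}\frac1{k!}\,\|\eta_k\|^2_{X\otimes\mathcal U^{\otimes k}},$$ where the series on the right converges. -/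

import Mathlib

open MeasureTheory ProbabilityTheory
open scoped TensorProduct InnerProductSpace ENNReal

universe u v w

namespace WienerChaos

/-! ### Hilbert tensor products -/

section Tensor

/-- The Hilbert tensor product: the completion of the algebraic tensor product for the inner
product determined by `⟪a ⊗ b, c ⊗ d⟫ = ⟪a, c⟫ * ⟪b, d⟫`. -/
abbrev HilbertTensor (E : Type u) (F : Type v)
    [NormedAddCommGroup E] [InnerProductSpace ℝ E]
    [NormedAddCommGroup F] [InnerProductSpace ℝ F] : Type (max u v) :=
  UniformSpace.Completion (E ⊗[ℝ] F)

/-- The pure tensor `x ⊗ y` in the Hilbert tensor product. -/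
noncomputable def htmul {E : Type u} {F : Type v}
    [NormedAddCommGroup E] [InnerProductSpace ℝ E]
    [NormedAddCommGroup F] [InnerProductSpace ℝ F] (x : E) (y : F) : HilbertTensor E F :=
  ((x ⊗ₜ[ℝ] y : E ⊗[ℝ] F) : UniformSpace.Completion (E ⊗[ℝ] F))

/-- A bundled real Hilbert space; only used to build the iterated tensor products by recursion. -/
structure RealHilbert : Type (w + 1) where
  carrier : Type w
  [normedAddCommGroup : NormedAddCommGroup carrier]
  [innerProductSpace : InnerProductSpace ℝ carrier]
  [completeSpace : CompleteSpace carrier]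

attribute [instance] RealHilbert.normedAddCommGroup RealHilbert.innerProductSpace
  RealHilbert.completeSpace

variable (X : Type u) (U : Type v)
  [NormedAddCommGroup X] [InnerProductSpace ℝ X]
  [NormedAddCommGroup U] [InnerProductSpace ℝ U]

/-- `X ⊗ U ⊗ ⋯ ⊗ U` with `n + 1` factors `U`, bracketed to the left, as a bundled Hilbert space. -/
noncomputable def hilbertTensorPow : ℕ → RealHilbert.{max u v}
  | 0 => ⟨HilbertTensor X U⟩
  | n + 1 => ⟨HilbertTensor (hilbertTensorPow n).carrier U⟩

/-- The Hilbert space `X ⊗ U^{⊗ (n + 1)}`. (The index is shifted by one: the factor `U` occurs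
`n + 1` times.) -/
abbrev TensorPow (n : ℕ) : Type (max u v) := (hilbertTensorPow X U n).carrier

variable {X U}

/-- The pure tensor `x ⊗ u 0 ⊗ ⋯ ⊗ u n` in `X ⊗ U^{⊗ (n + 1)}`. -/
noncomputable def pureTensor : (n : ℕ) → X → (Fin (n + 1) → U) → TensorPow X U n
  | 0, x, u => htmul x (u 0)
  | n + 1, x, u => htmul (pureTensor n x (Fin.init u)) (u (Fin.last (n + 1)))

variable (X U)

/-- The Hilbert space `X ⊗ U^{⊗̂ (n + 1)}`, where `U^{⊗̂ (n + 1)}` is the symmetric tensor power: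
the closed linear span, in `X ⊗ U^{⊗ (n + 1)}`, of the symmetrized tensors
`∑ σ, x ⊗ u (σ 0) ⊗ ⋯ ⊗ u (σ n)`. It carries the norm of `X ⊗ U^{⊗ (n + 1)}`. -/
noncomputable def symTensorPow (n : ℕ) : Submodule ℝ (TensorPow X U n) :=
  (Submodule.span ℝ {t : TensorPow X U n | ∃ (x : X) (u : Fin (n + 1) → U),
    t = ∑ σ : Equiv.Perm (Fin (n + 1)), pureTensor n x (u ∘ σ)}).topologicalClosure

end Tensor

/-! ### Gaussian white noise, Malliavin derivative and Skorokhod integral -/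

section Noise

variable {Ω : Type*} [MeasurableSpace Ω] {U : Type v} [NormedAddCommGroup U]
  [InnerProductSpace ℝ U]

/-- `W` is a zero-mean Gaussian family indexed by `U` whose covariance is the inner product of `U`,
and the σ-algebra of `Ω` is generated by `W`, up to null sets (so that both the σ-algebra generated
by `W` and its completion are allowed). -/
structure IsGaussianWhiteNoise (W : U → Ω → ℝ) (μ : Measure Ω) : Prop where
  measurable : ∀ h, Measurable (W h)
  gaussian : IsGaussianProcess W μ
  mean_zero : ∀ h, ∫ ω, W h ω ∂μ = 0
  covariance : ∀ h₁ h₂, ∫ ω, W h₁ ω * W h₂ ω ∂μ = ⟪h₁, h₂⟫_ℝ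
  generates : ∀ s : Set Ω, MeasurableSet s →
    ∃ t : Set Ω, MeasurableSet[⨆ h, MeasurableSpace.comap (W h) (borel ℝ)] t ∧ s =ᵐ[μ] t

/-- The graph of the Malliavin derivative on smooth functionals: pairs of `F (W h₁, …, W hₙ)` and
`∑ i, ∂ᵢF (W h₁, …, W hₙ) hᵢ`, where `F` is smooth and `F` and all its partial derivatives have at
most polynomial growth. -/
def smoothMalliavinGraph (W : U → Ω → ℝ) (μ : Measure Ω) : Set (Lp ℝ 2 μ × Lp U 2 μ) :=
  {p | ∃ (n : ℕ) (h : Fin n → U) (F : (Fin n → ℝ) → ℝ), F.HasTemperateGrowth ∧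
    (p.1 =ᵐ[μ] fun ω => F (fun i => W (h i) ω)) ∧
    (p.2 =ᵐ[μ] fun ω => ∑ i, fderiv ℝ F (fun j => W (h j) ω) (Pi.single i 1) • h i)}

/-- `HasMalliavinDeriv W μ φ G`: the random variable `φ` is in the domain `𝔻^{1,2}` of the Malliavin
derivative `D` and `D φ = G`, where `D` is the closure, as an operator from `L²` to `L²(U)`, of the
derivative on smooth functionals. -/
def HasMalliavinDeriv (W : U → Ω → ℝ) (μ : Measure Ω) (φ : Lp ℝ 2 μ) (G : Lp U 2 μ) : Prop :=
  (φ, G) ∈ closure (smoothMalliavinGraph W μ)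

variable {E : Type u} [NormedAddCommGroup E] [InnerProductSpace ℝ E]

/-- The duality relation `𝔼 (φ g) = 𝔼 (f, D φ)_U` in `E`, for all `φ` in the domain of `D`. It is
tested against the vectors `y : E`; the partial inner product `(t, u)_U` of `t ∈ E ⊗ U` with `u ∈ U`
is the vector of `E` given by `⟪(t, u)_U, y⟫ = ⟪t, y ⊗ u⟫`. -/
def SkorokhodDuality (W : U → Ω → ℝ) (μ : Measure Ω)
    (f : Lp (HilbertTensor E U) 2 μ) (g : Lp E 2 μ) : Prop :=
  ∀ (φ : Lp ℝ 2 μ) (G : Lp U 2 μ), HasMalliavinDeriv W μ φ G →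
    ∀ y : E, ∫ ω, φ ω * ⟪g ω, y⟫_ℝ ∂μ = ∫ ω, ⟪f ω, htmul y (G ω)⟫_ℝ ∂μ

/-- `HasSkorokhodIntegral W μ f g`: the random element `f` of `E ⊗ U` is in the domain of the
Skorokhod integral `δ`, and `δ f = g` is the unique element of `L²(E)` with the duality relation. -/
def HasSkorokhodIntegral (W : U → Ω → ℝ) (μ : Measure Ω)
    (f : Lp (HilbertTensor E U) 2 μ) (g : Lp E 2 μ) : Prop :=
  SkorokhodDuality W μ f g ∧ ∀ g' : Lp E 2 μ, SkorokhodDuality W μ f g' → g' = g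

/-- `HasMultipleSkorokhodIntegral W μ n f g`: the random element `f` of `X ⊗ U^{⊗ (n + 1)}` is in
the domain of the `(n + 1)`-fold Skorokhod integral and its value there is `g`. Each of the
`n + 1` steps integrates out the last factor `U`. -/
def HasMultipleSkorokhodIntegral {X : Type u} [NormedAddCommGroup X] [InnerProductSpace ℝ X]
    (W : U → Ω → ℝ) (μ : Measure Ω) :
    (n : ℕ) → Lp (TensorPow X U n) 2 μ → Lp X 2 μ → Prop
  | 0, f, g => HasSkorokhodIntegral (E := X) W μ f g
  | n + 1, f, g => ∃ h : Lp (TensorPow X U n) 2 μ,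
      HasSkorokhodIntegral (E := TensorPow X U n) W μ f h ∧
        HasMultipleSkorokhodIntegral W μ n h g

/-- The expansion `ζ = z₀ + ∑_{k ≥ 1} (1 / k!) δ^{⊗̂ k} (z_k)` in `L²(X)`, with deterministic
coefficients `z₀ ∈ X` and `z_k ∈ X ⊗ U^{⊗̂ k}`; here `z n` stands for `z_{n + 1}`. -/
def IsChaosExpansion {X : Type u} [NormedAddCommGroup X] [InnerProductSpace ℝ X]
    (W : U → Ω → ℝ) (μ : Measure Ω) [IsFiniteMeasure μ]
    (ζ : Lp X 2 μ) (z₀ : X) (z : (n : ℕ) → symTensorPow X U n) : Prop :=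
  ∃ I : ℕ → Lp X 2 μ,
    (∀ n, HasMultipleSkorokhodIntegral W μ n
      (Lp.const 2 μ (z n : TensorPow X U n)) (I n)) ∧
    HasSum (fun n => (1 / ((n + 1).factorial : ℝ)) • I n) (ζ - Lp.const 2 μ z₀)

end Noise

end WienerChaos

/-! This is the Wiener chaos decomposition with coefficients in `X`. For a unit vector `u`, Gaussian
integration by parts says that `δ` sends `He_k(W u) y ⊗ u` to `He_{k+1}(W u) y`
(`skorokhodDuality_hermiteLp`). Iterating from `He_0 = 1`, the `k`-fold integral of the
deterministic tensor `x ⊗ u^{⊗k}` is `He_k(W u) x`.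

The Gram matrix of the functionals `He_k(W u) x` is `k!` times that of the tensors `x ⊗ u^{⊗k}`, and
distinct degrees are orthogonal (`inner_hermiteLp`). By polarization these tensors have dense span
in the symmetric tensors (`symTensorPow_eq_closure_span`). So in each degree the multiple integral
is, up to the factor `√k!`, an isometry of the symmetric tensors onto the `k`-th chaos. The relation
`ChaosPair` records this correspondence through limits of linear combinations with common
coefficients.

The chaoses span a dense subspace: a square integrable variable orthogonal to all Hermite
functionals is orthogonal to all powers of `W u`, hence to all `exp(i W u)`, and vanishes because
`W` generates the σ-algebra (`ae_eq_zero_of_forall_integral_mul_pow`). Existence is then the Hilbert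
sum decomposition. Uniqueness and Parseval's identity follow by pairing an expansion with Hermite
functionals and with its own terms. -/

namespace WienerChaos

/-! ### Pure tensors in the Hilbert tensor product -/

section HilbertTensorProduct

variable {E : Type u} {F : Type v} [NormedAddCommGroup E] [InnerProductSpace ℝ E]
  [NormedAddCommGroup F] [InnerProductSpace ℝ F]

lemma htmul_add_left (x x' : E) (y : F) : htmul (x + x') y = htmul x y + htmul x' y := by
  simp only [htmul, TensorProduct.add_tmul, UniformSpace.Completion.coe_add]

lemma htmul_add_right (x : E) (y y' : F) : htmul x (y + y') = htmul x y + htmul x y' := by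
  simp only [htmul, TensorProduct.tmul_add, UniformSpace.Completion.coe_add]

lemma htmul_smul_left (c : ℝ) (x : E) (y : F) : htmul (c • x) y = c • htmul x y := by
  simp only [htmul, ← TensorProduct.smul_tmul', UniformSpace.Completion.coe_smul]

lemma htmul_smul_right (c : ℝ) (x : E) (y : F) : htmul x (c • y) = c • htmul x y := by
  simp only [htmul, TensorProduct.tmul_smul, UniformSpace.Completion.coe_smul]

lemma inner_htmul (x x' : E) (y y' : F) :
    ⟪htmul x y, htmul x' y'⟫_ℝ = ⟪x, x'⟫_ℝ * ⟪y, y'⟫_ℝ := by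
  simp only [htmul, UniformSpace.Completion.inner_coe, TensorProduct.inner_tmul]

lemma norm_htmul (x : E) (y : F) : ‖htmul x y‖ = ‖x‖ * ‖y‖ := by
  simp only [htmul, UniformSpace.Completion.norm_coe, TensorProduct.norm_tmul]

/-- Tensoring with a fixed left factor, as a continuous linear map. -/
noncomputable def htmulCLM (F : Type v) [NormedAddCommGroup F] [InnerProductSpace ℝ F] (x : E) :
    F →L[ℝ] HilbertTensor E F :=
  LinearMap.mkContinuous
    { toFun := fun y => htmul x y
      map_add' := htmul_add_right x
      map_smul' := fun c y => htmul_smul_right c x y } ‖x‖ fun y => (norm_htmul x y).le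

@[simp] lemma htmulCLM_apply (x : E) (y : F) : htmulCLM F x y = htmul x y := rfl

end HilbertTensorProduct

/-! ### Diagonal tensors and polarization -/

section TensorPower

variable {X : Type u} {U : Type v} [NormedAddCommGroup X] [InnerProductSpace ℝ X]
  [NormedAddCommGroup U] [InnerProductSpace ℝ U]

lemma pureTensor_succ (n : ℕ) (x : X) (u : Fin (n + 1 + 1) → U) :
    pureTensor (n + 1) x u =
      htmul (pureTensor n x (Fin.init u)) (u (Fin.last (n + 1))) := rfl

lemma pureTensor_update_add (n : ℕ) (x : X) (u : Fin (n + 1) → U) (i : Fin (n + 1)) (a b : U) :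
    pureTensor n x (Function.update u i (a + b)) =
      pureTensor n x (Function.update u i a) + pureTensor n x (Function.update u i b) := by
  induction n with
  | zero =>
    obtain rfl : i = 0 := Fin.fin_one_eq_zero i
    simpa [pureTensor] using! htmul_add_right x a b
  | succ n ih =>
    simp only [pureTensor_succ]
    induction i using Fin.lastCases with
    | last => simpa using! htmul_add_right (pureTensor n x (Fin.init u)) a b
    | cast j =>
      simp only [Fin.init_update_castSucc, ih, htmul_add_left]
      simp [Function.update_of_ne (Fin.castSucc_lt_last j).ne']
      rfl

lemma pureTensor_update_smul (n : ℕ) (x : X) (u : Fin (n + 1) → U) (i : Fin (n + 1)) (c : ℝ)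
    (a : U) : pureTensor n x (Function.update u i (c • a)) =
      c • pureTensor n x (Function.update u i a) := by
  induction n with
  | zero =>
    obtain rfl : i = 0 := Fin.fin_one_eq_zero i
    simpa [pureTensor] using! htmul_smul_right c x a
  | succ n ih =>
    simp only [pureTensor_succ]
    induction i using Fin.lastCases with
    | last => simpa using! htmul_smul_right c (pureTensor n x (Fin.init u)) a
    | cast j =>
      simp only [Fin.init_update_castSucc, ih, htmul_smul_left]
      simp [Function.update_of_ne (Fin.castSucc_lt_last j).ne']
      rfl

lemma norm_pureTensor (n : ℕ) (x : X) (u : Fin (n + 1) → U) :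
    ‖pureTensor n x u‖ = ‖x‖ * ∏ i, ‖u i‖ := by
  induction n with
  | zero => simpa using! norm_htmul x (u 0)
  | succ n ih =>
    rw [Fin.prod_univ_castSucc, ← mul_assoc]
    refine (norm_htmul (pureTensor n x (Fin.init u)) (u (Fin.last (n + 1)))).trans ?_
    rw [ih]
    rfl

/-- The pure tensor `x ⊗ u 0 ⊗ ⋯ ⊗ u n` as a continuous multilinear function of `u`. -/
noncomputable def pureTensorMultilinear (U : Type v) [NormedAddCommGroup U]
    [InnerProductSpace ℝ U] (n : ℕ) (x : X) :
    ContinuousMultilinearMap ℝ (fun _ : Fin (n + 1) => U) (TensorPow X U n) :=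
  MultilinearMap.mkContinuous
    { toFun := pureTensor n x
      map_update_add' := by
        intro inst u i a b
        -- `MultilinearMap` quantifies over all decidability instances, whereas the update lemma
        -- uses the canonical one.
        rw [Subsingleton.elim inst (instDecidableEqFin _)]
        exact pureTensor_update_add n x u i a b
      map_update_smul' := by
        intro inst u i c a
        rw [Subsingleton.elim inst (instDecidableEqFin _)]
        exact pureTensor_update_smul n x u i c a } ‖x‖
    fun u => (norm_pureTensor n x u).le

/-- The diagonal tensor `x ⊗ u ⊗ ⋯ ⊗ u`, with `n + 1` factors `u`. -/
noncomputable def diagTensor (n : ℕ) (x : X) (u : U) : TensorPow X U n :=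
  pureTensor n x fun _ => u

lemma inner_diagTensor (n : ℕ) (x y : X) (u v : U) :
    ⟪diagTensor n x u, diagTensor n y v⟫_ℝ = ⟪x, y⟫_ℝ * ⟪u, v⟫_ℝ ^ (n + 1) := by
  induction n with
  | zero => simpa using! inner_htmul x y u v
  | succ n ih =>
    refine (inner_htmul (diagTensor n x u) (diagTensor n y v) u v).trans ?_
    rw [ih]
    ring

lemma diagTensor_smul (n : ℕ) (x : X) (c : ℝ) (u : U) :
    diagTensor n x (c • u) = c ^ (n + 1) • diagTensor n x u := by
  have := (pureTensorMultilinear U n x).map_smul_univ (fun _ => c) fun _ => u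
  simpa [diagTensor, pureTensorMultilinear] using! this

/-- A vector that is orthogonal to all diagonal tensors is orthogonal to the symmetrized
tensors. -/
lemma inner_sum_pureTensor_eq_zero {n : ℕ} {w : TensorPow X U n}
    (hw : ∀ (x : X) (u : U), ⟪w, diagTensor n x u⟫_ℝ = 0) (x : X) (u : Fin (n + 1) → U) :
    ⟪w, ∑ σ : Equiv.Perm (Fin (n + 1)), pureTensor n x (u ∘ σ)⟫_ℝ = 0 := by
  -- Polarization: the top derivative at `0` of `y ↦ ⟪w, x ⊗ y ⊗ ⋯ ⊗ y⟫` is the sum over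
  -- permutations, and this function vanishes identically.
  have key := ContinuousMultilinearMap.iteratedFDeriv_comp_diagonal
    ((innerSL ℝ w).compContinuousMultilinearMap (pureTensorMultilinear U n x)) 0 u
  have hzero : (fun y : U => (innerSL ℝ w).compContinuousMultilinearMap
      (pureTensorMultilinear U n x) fun _ => y) = fun _ => 0 := by
    funext y
    exact hw x y
  rw [hzero, iteratedFDeriv_fun_zero] at key
  rw [inner_sum]
  exact key.symm

/-- The symmetric tensor power is the closed span of the diagonal tensors of unit vectors. -/
lemma symTensorPow_eq_closure_span (n : ℕ) :
    symTensorPow X U n = (Submodule.span ℝ (Set.range fun p : X × Metric.sphere (0 : U) 1 =>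
      diagTensor n p.1 (p.2 : U))).topologicalClosure := by
  apply le_antisymm
  · refine Submodule.topologicalClosure_minimal _ (Submodule.span_le.2 ?_)
      (Submodule.isClosed_topologicalClosure _)
    rintro _ ⟨x, u, rfl⟩
    -- By duality it suffices that a vector orthogonal to the unit diagonal tensors is orthogonal to
    -- the symmetrized ones. Homogeneity removes the restriction to unit vectors, and polarization
    -- does the rest.
    rw [SetLike.mem_coe, ← Submodule.orthogonal_orthogonal_eq_closure,
      Submodule.mem_orthogonal]
    intro w hw
    refine inner_sum_pureTensor_eq_zero (fun y v => ?_) x u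
    rcases eq_or_ne v 0 with rfl | hv
    · have := diagTensor_smul n y 0 (0 : U)
      rw [zero_smul, zero_pow n.succ_ne_zero, zero_smul] at this
      rw [this, inner_zero_right]
    · have hv' : ‖v‖ ≠ 0 := norm_ne_zero_iff.2 hv
      have h1 : v = ‖v‖ • (‖v‖⁻¹ • v) := by
        rw [smul_smul, mul_inv_cancel₀ hv', one_smul]
      rw [h1, diagTensor_smul, inner_smul_right]
      refine mul_eq_zero_of_right _ ?_
      refine Submodule.inner_left_of_mem_orthogonal (K := Submodule.span ℝ _) ?_ hw
      refine Submodule.subset_span ⟨(y, ⟨‖v‖⁻¹ • v, ?_⟩), rfl⟩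
      simp [norm_smul, hv']
  · refine Submodule.topologicalClosure_mono (Submodule.span_le.2 ?_)
    rintro _ ⟨⟨x, u⟩, rfl⟩
    -- Symmetrizing a constant tuple only multiplies by the number of permutations.
    have h1 : ∑ σ : Equiv.Perm (Fin (n + 1)), pureTensor n x ((fun _ => (u : U)) ∘ σ) =
        ((n + 1).factorial : ℝ) • diagTensor n x (u : U) := by
      have : ∀ σ : Equiv.Perm (Fin (n + 1)),
          pureTensor n x ((fun _ => (u : U)) ∘ σ) = diagTensor n x (u : U) := fun _ => rfl
      rw [Finset.sum_congr rfl fun σ _ => this σ, Finset.sum_const, Finset.card_univ,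
        Fintype.card_perm, Fintype.card_fin, Nat.cast_smul_eq_nsmul]
    have h2 : diagTensor n x (u : U) = ((n + 1).factorial : ℝ)⁻¹ •
        ∑ σ : Equiv.Perm (Fin (n + 1)), pureTensor n x ((fun _ => (u : U)) ∘ σ) := by
      rw [h1, smul_smul, inv_mul_cancel₀ (Nat.cast_ne_zero.2 (Nat.factorial_ne_zero _)), one_smul]
    simp only [SetLike.mem_coe]
    rw [h2]
    exact Submodule.smul_mem _ _ (Submodule.subset_span ⟨x, _, rfl⟩)

end TensorPower

/-! ### Hermite polynomials and one-dimensional Gaussian integration by parts -/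

section Hermite

/-- The Hermite polynomial function of degree `k`, orthogonal for the standard Gaussian measure. -/
noncomputable def hermiteFun (k : ℕ) (x : ℝ) : ℝ := Polynomial.aeval x (Polynomial.hermite k)

@[simp] lemma hermiteFun_zero (x : ℝ) : hermiteFun 0 x = 1 := by simp [hermiteFun]

/-- Differentiating `He_{k+2} = X He_{k+1} - He_{k+1}'` and inserting the inductive hypothesis
leaves `He_{k+1} + (k+1)(X He_k - He_k')`, whose bracket is again `He_{k+1}`. -/
lemma derivative_hermite_succ (k : ℕ) : Polynomial.derivative (Polynomial.hermite (k + 1)) =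
    ((k : Polynomial ℤ) + 1) * Polynomial.hermite k := by
  induction k with
  | zero => simp [Polynomial.hermite_succ]
  | succ k ih =>
    have hs := Polynomial.hermite_succ k
    rw [Polynomial.hermite_succ (k + 1), Polynomial.derivative_sub, Polynomial.derivative_mul,
      Polynomial.derivative_X, ih, Polynomial.derivative_mul]
    simp only [Polynomial.derivative_add, Polynomial.derivative_natCast, Polynomial.derivative_one]
    push_cast
    linear_combination ((k : Polynomial ℤ) + 1) * (-hs)

lemma hasDerivAt_hermiteFun_succ (k : ℕ) (x : ℝ) :
    HasDerivAt (hermiteFun (k + 1)) ((k + 1) * hermiteFun k x) x := by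
  have h := (Polynomial.hermite (k + 1)).hasDerivAt_aeval x
  rw [derivative_hermite_succ] at h
  refine HasDerivAt.congr_deriv h ?_
  simp [hermiteFun]

lemma hermiteFun_succ (k : ℕ) (x : ℝ) :
    hermiteFun (k + 1) x =
      x * hermiteFun k x - Polynomial.aeval x (Polynomial.derivative (Polynomial.hermite k)) := by
  simp [hermiteFun, Polynomial.hermite_succ]

lemma hermiteFun_one (x : ℝ) : hermiteFun 1 x = x := by simp [hermiteFun_succ]

/-- The three-term recurrence, by which powers are later traded for Hermite polynomials. -/
lemma mul_hermiteFun_succ (k : ℕ) (x : ℝ) :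
    x * hermiteFun (k + 1) x = hermiteFun (k + 2) x + (k + 1) * hermiteFun k x := by
  rw [hermiteFun_succ (k + 1), derivative_hermite_succ]
  simp [hermiteFun]

lemma hasTemperateGrowth_hermiteFun (k : ℕ) : (hermiteFun k).HasTemperateGrowth := by
  have : hermiteFun k = fun x => ∑ i ∈ Finset.range ((Polynomial.hermite k).natDegree + 1),
      (((Polynomial.hermite k).coeff i : ℤ) : ℝ) * x ^ i := by
    funext x
    simp [hermiteFun, Polynomial.aeval_eq_sum_range]
  rw [this]
  fun_prop

lemma hasDerivAt_gaussianPDFReal (x : ℝ) :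
    HasDerivAt (gaussianPDFReal 0 1) (-x * gaussianPDFReal 0 1 x) x := by
  have h1 : HasDerivAt (fun y : ℝ => -(y - 0) ^ 2 / (2 * ((1 : NNReal) : ℝ))) (-x) x := by
    have := ((((hasDerivAt_id x).sub_const 0).pow 2).neg).div_const (2 * ((1 : NNReal) : ℝ))
    refine this.congr_deriv ?_
    simp
    ring
  have h2 := (h1.exp).const_mul (√(2 * Real.pi * ((1 : NNReal) : ℝ)))⁻¹
  rw [gaussianPDFReal_def]
  refine h2.congr_deriv ?_
  ring

/-- Integration by parts for the standard Gaussian measure. -/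
lemma integral_hermiteFun_succ_mul (k : ℕ) {f f' : ℝ → ℝ} (hf : ∀ x, HasDerivAt f (f' x) x)
    (h₁ : Integrable (fun x => hermiteFun (k + 1) x * f x) (gaussianReal 0 1))
    (h₂ : Integrable (fun x => hermiteFun k x * f' x) (gaussianReal 0 1))
    (h₃ : Integrable (fun x => hermiteFun k x * f x) (gaussianReal 0 1)) :
    ∫ x, hermiteFun (k + 1) x * f x ∂gaussianReal 0 1 =
      ∫ x, hermiteFun k x * f' x ∂gaussianReal 0 1 := by
  have hint : ∀ g : ℝ → ℝ, Integrable g (gaussianReal 0 1) →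
      Integrable fun x => gaussianPDFReal 0 1 x * g x := by
    intro g hg
    rw [gaussianReal_of_var_ne_zero 0 one_ne_zero, integrable_withDensity_iff_integrable_smul'
      (measurable_gaussianPDF _ _) (ae_of_all _ fun _ => gaussianPDF_lt_top)] at hg
    simpa only [toReal_gaussianPDF, smul_eq_mul] using hg
  rw [integral_gaussianReal_eq_integral_smul one_ne_zero,
    integral_gaussianReal_eq_integral_smul one_ne_zero]
  -- The Hermite recursion says exactly that `(He_k ρ)' = -He_{k+1} ρ` for the Gaussian density `ρ`;
  -- integrability of the products removes the boundary terms.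
  have hv : ∀ x, HasDerivAt (fun y => hermiteFun k y * gaussianPDFReal 0 1 y)
      (-(hermiteFun (k + 1) x * gaussianPDFReal 0 1 x)) x := by
    intro x
    refine HasDerivAt.congr_deriv
      (((Polynomial.hermite k).hasDerivAt_aeval x).mul (hasDerivAt_gaussianPDFReal x)) ?_
    rw [hermiteFun_succ]
    simp only [hermiteFun]
    ring
  have key := integral_mul_deriv_eq_deriv_mul_of_integrable (u := f) (fun x _ => hf x)
    (fun x _ => hv x) ((hint _ h₁).neg.congr (ae_of_all _ fun x => ?_))
    ((hint _ h₂).congr (ae_of_all _ fun x => ?_)) ((hint _ h₃).congr (ae_of_all _ fun x => ?_))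
  · have e1 : (fun x => f x * -(hermiteFun (k + 1) x * gaussianPDFReal 0 1 x)) =
        fun x => -(gaussianPDFReal 0 1 x • (hermiteFun (k + 1) x * f x)) := by
      funext x
      simp only [smul_eq_mul]
      ring
    rw [e1, integral_neg, neg_inj] at key
    rw [key]
    congr 1
    funext x
    simp only [smul_eq_mul]
    ring
  all_goals
    simp only [Pi.mul_apply, Pi.neg_apply]
    ring

end Hermite

/-! ### Moments of functions of temperate growth -/

section TemperateGrowth

variable {Ω : Type*} [MeasurableSpace Ω] {μ : Measure Ω} [IsFiniteMeasure μ]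
  {G H : Type*} [NormedAddCommGroup G] [NormedSpace ℝ G] [NormedAddCommGroup H] [NormedSpace ℝ H]

lemma hasTemperateGrowth_fderiv {F : G → H} (hF : F.HasTemperateGrowth) :
    (fderiv ℝ F).HasTemperateGrowth := by
  refine ⟨hF.1.fderiv_right le_rfl, fun n => ?_⟩
  obtain ⟨k, C, h⟩ := hF.2 (n + 1)
  exact ⟨k, C, fun x => (norm_iteratedFDeriv_fderiv (n := n)).trans_le (h x)⟩

/-- A function of temperate growth maps a random vector with moments of all orders to a random
vector with moments of all orders. -/
lemma memLp_comp_of_hasTemperateGrowth {F : G → H} (hF : F.HasTemperateGrowth) {V : Ω → G}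
    (hV : ∀ p : ℝ≥0∞, p ≠ ∞ → MemLp V p μ) {p : ℝ≥0∞} (hp : p ≠ ∞) :
    MemLp (fun ω => F (V ω)) p μ := by
  obtain ⟨k, C, hC⟩ := hF.2 0
  have hpow : MemLp (fun ω => (1 + ‖V ω‖) ^ k) p μ := by
    rcases Nat.eq_zero_or_pos k with rfl | hk
    · simpa using memLp_const (1 : ℝ)
    -- The `k`-th power is in `L^p` because its base is in `L^{pk}`; the case `k = 0` is apart
    -- because the exponent gets divided by `k`.
    · have h1 : MemLp (fun ω => 1 + ‖V ω‖) (p * k) μ :=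
        (memLp_const (1 : ℝ)).add (hV _ (ENNReal.mul_ne_top hp (ENNReal.natCast_ne_top k))).norm
      have h2 := h1.norm_rpow_div (k : ℝ≥0∞)
      rw [ENNReal.mul_div_cancel_right (by exact_mod_cast hk.ne') (ENNReal.natCast_ne_top k)] at h2
      refine h2.congr_norm ?_ (ae_of_all _ fun ω => ?_)
      · have := (hV 0 ENNReal.zero_ne_top).1.norm
        exact (aestronglyMeasurable_const.add this).pow k
      · simp
  refine hpow.of_le_mul (c := C) (hF.1.continuous.comp_aestronglyMeasurable
    (hV 0 ENNReal.zero_ne_top).1) (ae_of_all _ fun ω => ?_)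
  have := hC (V ω)
  rw [norm_iteratedFDeriv_zero] at this
  refine this.trans_eq ?_
  rw [Real.norm_of_nonneg (by positivity)]

end TemperateGrowth

/-! ### Gaussian integration by parts for white noise -/

namespace IsGaussianWhiteNoise

variable {Ω : Type*} [MeasurableSpace Ω] {μ : Measure Ω} {U : Type v} [NormedAddCommGroup U]
  [InnerProductSpace ℝ U] {W : U → Ω → ℝ}

lemma isProbabilityMeasure (hW : IsGaussianWhiteNoise W μ) : IsProbabilityMeasure μ :=
  hW.gaussian.isProbabilityMeasure

lemma memLp (hW : IsGaussianWhiteNoise W μ) (h : U) {p : ℝ≥0∞} (hp : p ≠ ∞) :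
    MemLp (W h) p μ :=
  (hW.gaussian.hasGaussianLaw_eval h).memLp hp

lemma memLp_pi (hW : IsGaussianWhiteNoise W μ) {n : ℕ} (h : Fin n → U) {p : ℝ≥0∞} (hp : p ≠ ∞) :
    MemLp (fun ω i => W (h i) ω) p μ :=
  memLp_pi_iff.2 fun i => hW.memLp (h i) hp

lemma map_eq_gaussianReal (hW : IsGaussianWhiteNoise W μ) {u : U} (hu : ‖u‖ = 1) :
    μ.map (W u) = gaussianReal 0 1 := by
  rw [(hW.gaussian.hasGaussianLaw_eval u).map_eq_gaussianReal,
    variance_of_integral_eq_zero (hW.measurable u).aemeasurable (hW.mean_zero u), hW.mean_zero u]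
  have h := hW.covariance u u
  rw [real_inner_self_eq_norm_sq, hu] at h
  simp only [pow_two, h]
  simp

/-- The regression residuals of `W (h i)` on `W u` are independent of `W u`. -/
lemma indepFun_residual (hW : IsGaussianWhiteNoise W μ) {u : U} (hu : ‖u‖ = 1) {n : ℕ}
    (h : Fin n → U) :
    IndepFun (W u) (fun ω i => W (h i) ω - ⟪u, h i⟫_ℝ * W u ω) μ := by
  classical
  have := hW.isProbabilityMeasure
  -- The variable and the residuals are jointly Gaussian, being linear in the noise, so independence
  -- reduces to zero covariance: `⟪u, h i⟫ - ⟪u, h i⟫ ‖u‖² = 0`.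
  have hG : IsGaussianProcess (Sum.elim (fun _ : Unit => W u)
      (fun (i : Fin n) ω => W (h i) ω - ⟪u, h i⟫_ℝ * W u ω)) μ := by
    refine hW.gaussian.of_isGaussianProcess fun s => ?_
    rcases s with _ | i
    · exact ⟨{u}, ContinuousLinearMap.proj ⟨u, by simp⟩, fun ω => rfl⟩
    · refine ⟨{u, h i}, ContinuousLinearMap.proj ⟨h i, by simp⟩ -
        ⟪u, h i⟫_ℝ • ContinuousLinearMap.proj ⟨u, by simp⟩, fun ω => rfl⟩
  have hR : ∀ i, MemLp (fun ω => W (h i) ω - ⟪u, h i⟫_ℝ * W u ω) 2 μ := fun i =>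
    (hW.memLp (h i) (by simp)).sub ((hW.memLp u (by simp)).const_mul _)
  have hind := hG.indepFun_of_covariance_eq_zero (fun _ => (hW.measurable u).aemeasurable)
    (fun i => (hR i).1.aemeasurable) fun _ i => by
      have h2 : ∀ a b : U, Integrable (fun ω => W a ω * W b ω) μ := fun a b =>
        (hW.memLp a (p := 2) (by simp)).integrable_mul (hW.memLp b (p := 2) (by simp))
      rw [covariance_eq_sub (hW.memLp u (by simp)) (hR i), hW.mean_zero, zero_mul, sub_zero]
      have : (W u * fun ω => W (h i) ω - ⟪u, h i⟫_ℝ * W u ω) =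
          fun ω => W u ω * W (h i) ω - ⟪u, h i⟫_ℝ * (W u ω * W u ω) := by
        funext ω
        simp only [Pi.mul_apply]
        ring
      rw [this, integral_sub (h2 _ _) ((h2 _ _).const_mul _), integral_const_mul, hW.covariance,
        hW.covariance, real_inner_self_eq_norm_sq, hu]
      ring
  exact hind.comp (φ := fun x : Unit → ℝ => x ()) (ψ := id) (measurable_pi_apply ()) measurable_id

/-- Gaussian integration by parts for smooth functionals of white noise. -/
lemma integral_hermiteFun_succ_mul (hW : IsGaussianWhiteNoise W μ) {u : U} (hu : ‖u‖ = 1) {n : ℕ}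
    (h : Fin n → U) (k : ℕ) {F : (Fin n → ℝ) → ℝ} (hF : F.HasTemperateGrowth) :
    ∫ ω, hermiteFun (k + 1) (W u ω) * F (fun i => W (h i) ω) ∂μ =
      ∫ ω, hermiteFun k (W u ω) *
        fderiv ℝ F (fun i => W (h i) ω) (fun i => ⟪u, h i⟫_ℝ) ∂μ := by
  have := hW.isProbabilityMeasure
  -- With the independent residual `R` frozen at `r`, the vector `(W (h i))` runs along the line `r
  -- + x • ρ` with `x` standard Gaussian. The one-dimensional formula applies on each line, and the
  -- derivative along it is `fderiv` in the direction `ρ`.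
  set ρ : Fin n → ℝ := fun i => ⟪u, h i⟫_ℝ with hρ
  set R : Ω → Fin n → ℝ := fun ω i => W (h i) ω - ⟪u, h i⟫_ℝ * W u ω with hR
  have hRm : Measurable R := measurable_pi_lambda _ fun i =>
    (hW.measurable (h i)).sub ((hW.measurable u).const_mul _)
  have hF' : (fun x => fderiv ℝ F x ρ).HasTemperateGrowth :=
    (ContinuousLinearMap.apply ℝ ℝ ρ).hasTemperateGrowth.comp (hasTemperateGrowth_fderiv hF)
  have hadd : ∀ ω, (fun i => W (h i) ω) = R ω + W u ω • ρ := by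
    intro ω
    funext i
    simp [hR, hρ]
    ring
  have hmap : μ.map (fun ω => (W u ω, R ω)) = (gaussianReal 0 1).prod (μ.map R) := by
    rw [(indepFun_iff_map_prod_eq_prod_map_map (hW.measurable u).aemeasurable
      hRm.aemeasurable).1 (hW.indepFun_residual hu h), hW.map_eq_gaussianReal hu]
  have : IsProbabilityMeasure (μ.map R) := Measure.isProbabilityMeasure_map hRm.aemeasurable
  have hpair : Measurable fun ω => (W u ω, R ω) := (hW.measurable u).prodMk hRm
  have transfer : ∀ (j : ℕ) (G : (Fin n → ℝ) → ℝ), G.HasTemperateGrowth →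
      ∫ ω, hermiteFun j (W u ω) * G (fun i => W (h i) ω) ∂μ =
        ∫ r, ∫ x, hermiteFun j x * G (r + x • ρ) ∂gaussianReal 0 1 ∂(μ.map R) := by
    intro j G hG
    have hcont : Continuous fun p : ℝ × (Fin n → ℝ) => hermiteFun j p.1 * G (p.2 + p.1 • ρ) :=
      ((hasTemperateGrowth_hermiteFun j).1.continuous.comp continuous_fst).mul
        (hG.1.continuous.comp (continuous_snd.add (continuous_fst.smul continuous_const)))
    have hi : Integrable (fun ω => hermiteFun j (W u ω) * G (fun i => W (h i) ω)) μ :=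
      (memLp_comp_of_hasTemperateGrowth (hasTemperateGrowth_hermiteFun j)
        (fun p hp => hW.memLp u hp) (p := 2) (by simp)).integrable_mul
        (memLp_comp_of_hasTemperateGrowth hG (fun p hp => hW.memLp_pi h hp) (p := 2) (by simp))
    simp only [hadd] at hi ⊢
    have hi' := (integrable_map_measure (f := fun ω => (W u ω, R ω))
      hcont.aestronglyMeasurable hpair.aemeasurable).2 hi
    rw [hmap] at hi'
    rw [← integral_prod_symm _ hi', ← hmap,
      integral_map hpair.aemeasurable hcont.aestronglyMeasurable]
  rw [transfer _ _ hF, transfer k _ hF']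
  congr 1
  funext r
  have hid : ∀ p : ℝ≥0∞, p ≠ ∞ → MemLp (fun x : ℝ => x) p (gaussianReal 0 1) := fun p hp =>
    memLp_id_gaussianReal' p hp
  have hint : ∀ (j : ℕ) (G : (Fin n → ℝ) → ℝ), G.HasTemperateGrowth →
      Integrable (fun x => hermiteFun j x * G (r + x • ρ)) (gaussianReal 0 1) := by
    intro j G hG
    have hG' : (fun x : ℝ => G (r + x • ρ)).HasTemperateGrowth :=
      hG.comp (f := fun x : ℝ => r + x • ρ) (by fun_prop)
    exact (memLp_comp_of_hasTemperateGrowth (hasTemperateGrowth_hermiteFun j) hid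
        (p := 2) (by simp)).integrable_mul
        (memLp_comp_of_hasTemperateGrowth hG' hid (p := 2) (by simp))
  refine WienerChaos.integral_hermiteFun_succ_mul k (fun x => ?_) (hint _ _ hF) (hint _ _ hF')
    (hint _ _ hF)
  have h1 : HasDerivAt (fun x : ℝ => r + x • ρ) ρ x := by
    simpa using ((hasDerivAt_id x).smul_const ρ).const_add r
  exact ((hF.1.differentiable (by simp)) _).hasFDerivAt.comp_hasDerivAt x h1

end IsGaussianWhiteNoise

/-! ### Orthogonality of Hermite functionals; linearity and exponential moments of the noise -/

namespace IsGaussianWhiteNoise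

variable {Ω : Type*} [MeasurableSpace Ω] {μ : Measure Ω} {U : Type v} [NormedAddCommGroup U]
  [InnerProductSpace ℝ U] {W : U → Ω → ℝ}

lemma memLp_hermiteFun (hW : IsGaussianWhiteNoise W μ) (k : ℕ) (u : U) {p : ℝ≥0∞} (hp : p ≠ ∞) :
    MemLp (fun ω => hermiteFun k (W u ω)) p μ := by
  have := hW.isProbabilityMeasure
  exact memLp_comp_of_hasTemperateGrowth (hasTemperateGrowth_hermiteFun k)
    (fun p hp => hW.memLp u hp) hp

/-- Integration by parts with `F = He_{k+1}` of the single variable `W v`: the derivative gives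
`(k+1) He_k`, the direction gives `⟪u, v⟫`. Both degrees drop by one, which drives the induction in
`integral_hermiteFun_mul`. -/
lemma integral_hermiteFun_mul_succ (hW : IsGaussianWhiteNoise W μ) {u v : U} (hu : ‖u‖ = 1)
    (j k : ℕ) :
    ∫ ω, hermiteFun (j + 1) (W u ω) * hermiteFun (k + 1) (W v ω) ∂μ =
      (k + 1) * ⟪u, v⟫_ℝ * ∫ ω, hermiteFun j (W u ω) * hermiteFun k (W v ω) ∂μ := by
  have h := hW.integral_hermiteFun_succ_mul hu (fun _ : Fin 1 => v) j
    (F := fun x => hermiteFun (k + 1) (x 0))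
    ((hasTemperateGrowth_hermiteFun (k + 1)).comp
      (ContinuousLinearMap.proj (R := ℝ) (φ := fun _ : Fin 1 => ℝ) 0).hasTemperateGrowth)
  rw [h, ← integral_const_mul]
  congr 1
  funext ω
  have hd : HasFDerivAt (fun x : Fin 1 → ℝ => hermiteFun (k + 1) (x 0))
      (((k + 1) * hermiteFun k (W v ω)) •
        ContinuousLinearMap.proj (R := ℝ) (φ := fun _ : Fin 1 => ℝ) 0) (fun _ => W v ω) :=
    HasDerivAt.comp_hasFDerivAt (f := fun x : Fin 1 → ℝ => x 0) (fun _ : Fin 1 => W v ω)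
      (hasDerivAt_hermiteFun_succ k (W v ω))
      (ContinuousLinearMap.proj (R := ℝ) (φ := fun _ : Fin 1 => ℝ) 0).hasFDerivAt
  rw [hd.fderiv]
  simp
  ring

lemma integral_hermiteFun_succ (hW : IsGaussianWhiteNoise W μ) {u : U} (hu : ‖u‖ = 1) (j : ℕ) :
    ∫ ω, hermiteFun (j + 1) (W u ω) ∂μ = 0 := by
  have h := hW.integral_hermiteFun_succ_mul hu (fun i : Fin 0 => i.elim0) j (F := fun _ => 1)
    (Function.HasTemperateGrowth.const 1)
  simpa using h

/-- Hermite functionals of distinct degrees are orthogonal. -/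
lemma integral_hermiteFun_mul (hW : IsGaussianWhiteNoise W μ) {u v : U} (hu : ‖u‖ = 1)
    (hv : ‖v‖ = 1) (j k : ℕ) :
    ∫ ω, hermiteFun j (W u ω) * hermiteFun k (W v ω) ∂μ =
      if j = k then (k.factorial : ℝ) * ⟪u, v⟫_ℝ ^ k else 0 := by
  have := hW.isProbabilityMeasure
  induction j generalizing k with
  | zero =>
    cases k with
    | zero => simp
    | succ k => simp [hW.integral_hermiteFun_succ hv]
  | succ j ih =>
    cases k with
    | zero => simp [hW.integral_hermiteFun_succ hu]
    | succ k =>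
      rw [hW.integral_hermiteFun_mul_succ hu, ih k]
      simp only [Nat.add_right_cancel_iff, Nat.factorial_succ]
      split_ifs
      · push_cast
        ring
      · simp

lemma inner_toLp (hW : IsGaussianWhiteNoise W μ) (h k : U) :
    ⟪(hW.memLp h (p := 2) (by simp)).toLp (W h),
      (hW.memLp k (p := 2) (by simp)).toLp (W k)⟫_ℝ = ⟪h, k⟫_ℝ := by
  rw [L2.inner_def, ← hW.covariance h k]
  refine integral_congr_ae ?_
  filter_upwards [(hW.memLp h (p := 2) (by simp)).coeFn_toLp,
    (hW.memLp k (p := 2) (by simp)).coeFn_toLp] with ω h1 h2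
  rw [h1, h2]
  simp [mul_comm]

/-- White noise is linear, almost surely. -/
lemma sum_mul_ae_eq (hW : IsGaussianWhiteNoise W μ) {ι : Type*} (s : Finset ι) (a : ι → ℝ)
    (h : ι → U) : (fun ω => ∑ i ∈ s, a i * W (h i) ω) =ᵐ[μ] W (∑ i ∈ s, a i • h i) := by
  have := hW.isProbabilityMeasure
  set w : U → Lp ℝ 2 μ := fun h => (hW.memLp h (p := 2) (by simp)).toLp (W h) with hw
  have hinner : ∀ h k, ⟪w h, w k⟫_ℝ = ⟪h, k⟫_ℝ := hW.inner_toLp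
  -- The difference of the two sides is orthogonal to every `w k` and is itself a combination of
  -- such vectors, hence orthogonal to itself.
  have horth : ∀ k, ⟪∑ i ∈ s, a i • w (h i) - w (∑ i ∈ s, a i • h i), w k⟫_ℝ = 0 := by
    intro k
    simp only [inner_sub_left, sum_inner, inner_smul_left, hinner, sub_self]
  have hzero : ∑ i ∈ s, a i • w (h i) = w (∑ i ∈ s, a i • h i) := by
    rw [← sub_eq_zero, ← inner_self_eq_zero (𝕜 := ℝ)]
    conv_lhs => rw [inner_sub_right, inner_sum]
    simp only [inner_smul_right, horth, mul_zero, Finset.sum_const_zero, sub_self]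
  have h1 : (∑ i ∈ s, a i • w (h i) : Lp ℝ 2 μ) =ᵐ[μ] fun ω => ∑ i ∈ s, a i * W (h i) ω := by
    have h2 : ∀ i, (a i • w (h i) : Lp ℝ 2 μ) =ᵐ[μ] fun ω => a i * W (h i) ω := fun i => by
      filter_upwards [Lp.coeFn_smul (a i) (w (h i)),
        (hW.memLp (h i) (p := 2) (by simp)).coeFn_toLp] with ω h3 h4
      rw [h3, Pi.smul_apply, h4, smul_eq_mul]
    filter_upwards [Lp.coeFn_finsetSum s fun i => a i • w (h i),
      (Finset.eventually_all s).2 fun i _ => h2 i] with ω h3 h4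
    rw [h3, Finset.sum_apply]
    exact Finset.sum_congr rfl h4
  refine h1.symm.trans ?_
  rw [hzero]
  exact (hW.memLp _ (by simp)).coeFn_toLp

/-- Supplies the dominating function for the exponential series in `integral_mul_cexp_eq_zero`. -/
lemma memLp_exp_abs (hW : IsGaussianWhiteNoise W μ) (u : U) :
    MemLp (fun ω => Real.exp |W u ω|) 2 μ := by
  have hexp : ∀ t : ℝ, Integrable (fun ω => Real.exp (t * W u ω)) μ := by
    intro t
    have h := integrable_exp_mul_gaussianReal (μ := μ[W u]) (v := Var[W u; μ].toNNReal) t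
    rw [← (hW.gaussian.hasGaussianLaw_eval u).map_eq_gaussianReal] at h
    exact h.comp_measurable (hW.measurable u)
  refine (memLp_two_iff_integrable_sq (f := fun ω => Real.exp |W u ω|)
    (Real.measurable_exp.comp (measurable_norm.comp (hW.measurable u))).aestronglyMeasurable).2 ?_
  refine (integrable_exp_mul_abs (t := 2) (hexp 2) (hexp (-2))).congr (ae_of_all _ fun ω => ?_)
  simp only
  rw [← Real.exp_nat_mul]
  norm_num

end IsGaussianWhiteNoise

/-! ### Totality of the polynomials in white noise -/

namespace IsGaussianWhiteNoise

variable {Ω : Type*} [MeasurableSpace Ω] {μ : Measure Ω} {U : Type v} [NormedAddCommGroup U]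
  [InnerProductSpace ℝ U] {W : U → Ω → ℝ}

/-- The exponential series may be integrated term by term, since `|ξ| exp |W u|` dominates it and is
a product of two square integrable functions. -/
lemma integral_mul_cexp_eq_zero (hW : IsGaussianWhiteNoise W μ) {ξ : Ω → ℝ} (hξ : MemLp ξ 2 μ)
    (u : U) (h : ∀ n : ℕ, ∫ ω, ξ ω * W u ω ^ n ∂μ = 0) :
    ∫ ω, (ξ ω : ℂ) * Complex.exp (W u ω * Complex.I) ∂μ = 0 := by
  have hsum : ∀ x : ℝ, HasSum (fun n : ℕ => |x| ^ n / n.factorial) (Real.exp |x|) := fun x => by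
    rw [Real.exp_eq_exp_ℝ]
    exact NormedSpace.expSeries_div_hasSum_exp |x|
  have key := hasSum_integral_of_dominated_convergence (μ := μ)
    (F := fun (n : ℕ) ω => (ξ ω : ℂ) * ((W u ω * Complex.I) ^ n / n.factorial))
    (f := fun ω => (ξ ω : ℂ) * Complex.exp (W u ω * Complex.I))
    (fun n ω => |ξ ω| * (|W u ω| ^ n / n.factorial)) (fun n => ?_)
    (fun n => ae_of_all _ fun ω => ?_) (ae_of_all _ fun ω => (hsum _).summable.mul_left _) ?_
    (ae_of_all _ fun ω => ?_)
  · refine key.unique ?_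
    have hz : ∀ n : ℕ, ∫ ω, (ξ ω : ℂ) * ((W u ω * Complex.I) ^ n / n.factorial) ∂μ = 0 := by
      intro n
      have : (fun ω => (ξ ω : ℂ) * ((W u ω * Complex.I) ^ n / n.factorial)) =
          fun ω => (Complex.I ^ n / n.factorial) * ((ξ ω * W u ω ^ n : ℝ) : ℂ) := by
        funext ω
        push_cast
        ring
      rw [this, integral_const_mul, integral_complex_ofReal, h n]
      simp
    simp only [hz]
    exact hasSum_zero
  · have h1 : AEStronglyMeasurable (fun ω => (ξ ω : ℂ)) μ :=
      Complex.continuous_ofReal.comp_aestronglyMeasurable hξ.1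
    have h2 : Continuous fun x : ℝ => ((x * Complex.I) ^ n / n.factorial : ℂ) := by fun_prop
    exact h1.mul (h2.comp_aestronglyMeasurable (hW.measurable u).aestronglyMeasurable)
  · simp
  · have : (fun ω => ∑' n : ℕ, |ξ ω| * (|W u ω| ^ n / n.factorial)) =
        fun ω => |ξ ω| * Real.exp |W u ω| := by
      funext ω
      rw [tsum_mul_left, (hsum _).tsum_eq]
    rw [this]
    exact hξ.abs.integrable_mul (hW.memLp_exp_abs u)
  · rw [Complex.exp_eq_exp_ℂ]
    exact (NormedSpace.expSeries_div_hasSum_exp (W u ω * Complex.I : ℂ)).mul_left _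

/-- The polynomials in white noise are total in the space of square integrable functions. -/
lemma ae_eq_zero_of_forall_integral_mul_pow (hW : IsGaussianWhiteNoise W μ) {ξ : Ω → ℝ}
    (hm : Measurable ξ) (hξ : MemLp ξ 2 μ) (h : ∀ (u : U) (n : ℕ), ∫ ω, ξ ω * W u ω ^ n ∂μ = 0) :
    ξ =ᵐ[μ] 0 := by
  have := hW.isProbabilityMeasure
  have hint : Integrable ξ μ := hξ.integrable (by norm_num)
  -- The positive and negative parts of `ξ` become two finite measures. It is enough that the whole
  -- noise `Φ` has the same image law under both, which is checked on finite-dimensional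
  -- characteristic functions.
  set ν₁ := μ.withDensity fun ω => ENNReal.ofReal (ξ ω) with hν₁
  set ν₂ := μ.withDensity fun ω => ENNReal.ofReal (-ξ ω) with hν₂
  have : IsFiniteMeasure ν₁ := isFiniteMeasure_withDensity_ofReal hint.2
  have : IsFiniteMeasure ν₂ := isFiniteMeasure_withDensity_ofReal hint.neg.2
  set Φ : Ω → U → ℝ := fun ω u => W u ω with hΦ
  have hΦm : Measurable Φ := measurable_pi_lambda _ hW.measurable
  have hmap : ν₁.map Φ = ν₂.map Φ := by
    refine IsProjectiveLimit.unique (P := fun I => (ν₂.map Φ).map I.restrict) (fun I => ?_)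
      fun I => rfl
    have hres : Measurable (I.restrict (π := fun _ : U => ℝ)) := Finset.measurable_restrict I
    change (ν₁.map Φ).map I.restrict = (ν₂.map Φ).map I.restrict
    rw [Measure.map_map hres hΦm, Measure.map_map hres hΦm]
    refine Measure.ext_of_charFunDual (funext fun L => ?_)
    have hmeas : Measurable (I.restrict ∘ Φ) := hres.comp hΦm
    have hcont : Continuous fun x : (I → ℝ) => Complex.exp (L x * Complex.I) := by fun_prop
    rw [charFunDual_apply, charFunDual_apply,
      integral_map hmeas.aemeasurable hcont.aestronglyMeasurable,
      integral_map hmeas.aemeasurable hcont.aestronglyMeasurable]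
    classical
    set a : I → ℝ := fun i => L (Pi.single i 1) with ha
    -- A linear form in finitely many noise variables is almost surely one noise variable, so powers
    -- of a single `W u` suffice in the hypothesis.
    have hL : (fun ω => L ((I.restrict ∘ Φ) ω)) =ᵐ[μ] W (∑ i, a i • (i : U)) := by
      refine Filter.EventuallyEq.trans (ae_of_all _ fun ω => ?_)
        (hW.sum_mul_ae_eq Finset.univ a fun i : I => (i : U))
      change L ((I.restrict ∘ Φ) ω) = _
      rw [← Finset.univ_sum_single ((I.restrict ∘ Φ) ω), map_sum]
      refine Finset.sum_congr rfl fun i _ => ?_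
      have : Pi.single i ((I.restrict ∘ Φ) ω i) =
          (W i ω) • (Pi.single i 1 : I → ℝ) := by
        rw [← Pi.single_smul, smul_eq_mul, mul_one]
        rfl
      rw [this, map_smul, smul_eq_mul, mul_comm]
    set e : Ω → ℂ := fun ω => Complex.exp (L ((I.restrict ∘ Φ) ω) * Complex.I) with he
    have hem : Measurable e := hcont.measurable.comp hmeas
    have hbound : ∀ ω, ‖e ω‖ ≤ 1 := fun ω => by
      simp [he, Complex.norm_exp_ofReal_mul_I]
    have hz : ∫ ω, (ξ ω : ℂ) * e ω ∂μ = 0 := by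
      rw [← hW.integral_mul_cexp_eq_zero hξ (∑ i, a i • (i : U)) (h _)]
      refine integral_congr_ae ?_
      filter_upwards [hL] with ω hω
      simp only [he, hω]
    change ∫ ω, e ω ∂ν₁ = ∫ ω, e ω ∂ν₂
    rw [hν₁, hν₂, integral_withDensity_eq_integral_toReal_smul (by fun_prop) (by simp),
      integral_withDensity_eq_integral_toReal_smul (by fun_prop) (by simp), ← sub_eq_zero,
      ← integral_sub]
    · rw [← hz]
      congr 1
      funext ω
      simp only [ENNReal.toReal_ofReal', Complex.real_smul]
      rcases le_total 0 (ξ ω) with h0 | h0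
      · rw [max_eq_left h0, max_eq_right (by linarith)]
        simp
      · rw [max_eq_right h0, max_eq_left (by linarith)]
        simp
    · exact hint.real_toNNReal.smul_bdd 1 hem.aestronglyMeasurable (ae_of_all _ hbound)
    · exact hint.neg.real_toNNReal.smul_bdd 1 hem.aestronglyMeasurable (ae_of_all _ hbound)
  -- Up to a null set, `s` is the preimage under `Φ` of a measurable set, and there the integral of
  -- `ξ` is the difference of two equal masses.
  refine hint.ae_eq_zero_of_forall_setIntegral_eq_zero fun s hs _ => ?_
  obtain ⟨t, ht, hst⟩ := hW.generates s hs
  obtain ⟨A, hA, rfl⟩ : ∃ A : Set (U → ℝ), MeasurableSet A ∧ Φ ⁻¹' A = t := by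
    have hcomap : (⨆ h, MeasurableSpace.comap (W h) (borel ℝ)) =
        MeasurableSpace.comap Φ MeasurableSpace.pi := by
      simp only [MeasurableSpace.pi, MeasurableSpace.comap_iSup, MeasurableSpace.comap_comp,
        BorelSpace.measurable_eq (α := ℝ)]
      rfl
    rw [hcomap] at ht
    exact ht
  have htm : MeasurableSet (Φ ⁻¹' A) := hΦm hA
  rw [setIntegral_congr_set hst, integral_eq_lintegral_pos_part_sub_lintegral_neg_part
    hint.integrableOn, ← withDensity_apply _ htm, ← withDensity_apply _ htm, ← hν₁, ← hν₂,
    ← Measure.map_apply hΦm hA, ← Measure.map_apply hΦm hA, hmap, sub_self]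

end IsGaussianWhiteNoise

/-! ### Hermite functionals with values in a Hilbert space -/

namespace IsGaussianWhiteNoise

variable {Ω : Type*} [MeasurableSpace Ω] {μ : Measure Ω} {U : Type v} [NormedAddCommGroup U]
  [InnerProductSpace ℝ U] {W : U → Ω → ℝ}
  {E : Type u} [NormedAddCommGroup E] [InnerProductSpace ℝ E]

/-- A square integrable function that is orthogonal to all Hermite functionals of white noise is
orthogonal to all polynomials in white noise. -/
lemma integral_mul_pow_eq_zero (hW : IsGaussianWhiteNoise W μ) {ξ : Ω → ℝ} (hξ : MemLp ξ 2 μ)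
    (h₀ : ∫ ω, ξ ω ∂μ = 0)
    (h : ∀ (u : U) (k : ℕ), ‖u‖ = 1 → ∫ ω, ξ ω * hermiteFun (k + 1) (W u ω) ∂μ = 0)
    (u : U) (n : ℕ) : ∫ ω, ξ ω * W u ω ^ n ∂μ = 0 := by
  have := hW.isProbabilityMeasure
  -- The extra Hermite factor makes the induction on the power close: the three-term recurrence
  -- absorbs one factor `W v` by shifting the degree.
  have hunit : ∀ (v : U), ‖v‖ = 1 → ∀ n k : ℕ,
      ∫ ω, ξ ω * (W v ω ^ n * hermiteFun k (W v ω)) ∂μ = 0 := by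
    intro v hv n
    have hint : ∀ n k : ℕ, Integrable (fun ω => ξ ω * (W v ω ^ n * hermiteFun k (W v ω))) μ := by
      intro n k
      have hT : (fun x : ℝ => x ^ n * hermiteFun k x).HasTemperateGrowth :=
        (Function.HasTemperateGrowth.id'.pow n).mul (hasTemperateGrowth_hermiteFun k)
      exact hξ.integrable_mul (memLp_comp_of_hasTemperateGrowth hT
        (fun p hp => hW.memLp v hp) (p := 2) (by simp))
    induction n with
    | zero =>
      intro k
      cases k with
      | zero => simpa using h₀
      | succ k => simpa using h v k hv
    | succ n ih =>
      intro k
      cases k with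
      | zero => simpa [pow_succ, hermiteFun_one] using ih 1
      | succ k =>
        have : (fun ω => ξ ω * (W v ω ^ (n + 1) * hermiteFun (k + 1) (W v ω))) =
            fun ω => ξ ω * (W v ω ^ n * hermiteFun (k + 2) (W v ω)) +
              (k + 1) * (ξ ω * (W v ω ^ n * hermiteFun k (W v ω))) := by
          funext ω
          rw [pow_succ, mul_assoc (W v ω ^ n), mul_hermiteFun_succ]
          ring
        rw [this, integral_add (hint _ _) ((hint _ _).const_mul _), integral_const_mul, ih, ih]
        simp
  rcases eq_or_ne u 0 with rfl | hu
  · have hz : (fun _ => 0) =ᵐ[μ] W 0 := by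
      simpa using hW.sum_mul_ae_eq (∅ : Finset U) (fun _ => 0) fun _ => 0
    rw [integral_congr_ae (g := fun ω => ξ ω * 0 ^ n) (by
      filter_upwards [hz] with ω hω
      rw [← hω]), integral_mul_const, h₀, zero_mul]
  · have hu' : ‖u‖ ≠ 0 := norm_ne_zero_iff.2 hu
    have hv : ‖‖u‖⁻¹ • u‖ = 1 := by simp [norm_smul, hu']
    have hz : (fun ω => ‖u‖ * W (‖u‖⁻¹ • u) ω) =ᵐ[μ] W u := by
      simpa [smul_smul, hu'] using
        hW.sum_mul_ae_eq (Finset.univ : Finset Unit) (fun _ => ‖u‖) fun _ => ‖u‖⁻¹ • u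
    rw [integral_congr_ae
      (g := fun ω => ‖u‖ ^ n * (ξ ω * (W (‖u‖⁻¹ • u) ω ^ n * hermiteFun 0 (W (‖u‖⁻¹ • u) ω)))) (by
      filter_upwards [hz] with ω hω
      rw [← hω, hermiteFun_zero]
      ring), integral_const_mul, hunit _ hv, mul_zero]

/-- The polynomials in white noise with coefficients in a Hilbert space are total. -/
lemma Lp_eq_zero_of_forall_integral_pow [CompleteSpace E] (hW : IsGaussianWhiteNoise W μ)
    (g : Lp E 2 μ) (h : ∀ (y : E) (u : U) (n : ℕ), ∫ ω, ⟪g ω, y⟫_ℝ * W u ω ^ n ∂μ = 0) :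
    g = 0 := by
  have := hW.isProbabilityMeasure
  rw [Lp.eq_zero_iff_ae_eq_zero]
  have hint : Integrable g μ := (Lp.memLp g).integrable (by norm_num)
  refine hint.ae_eq_zero_of_forall_setIntegral_eq_zero fun s _ _ => ?_
  refine integral_eq_zero_of_forall_integral_inner_eq_zero ℝ _ hint.integrableOn fun y => ?_
  have hy : (fun ω => ⟪g ω, y⟫_ℝ) =ᵐ[μ] 0 :=
    hW.ae_eq_zero_of_forall_integral_mul_pow
      ((Lp.stronglyMeasurable g).inner stronglyMeasurable_const).measurable
      ((Lp.memLp g).inner_const y) (h y)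
  rw [integral_congr_ae (g := fun _ => (0 : ℝ))]
  · simp
  · filter_upwards [ae_restrict_of_ae hy] with ω hω
    rw [real_inner_comm]
    exact hω

lemma memLp_hermiteFun_smul (hW : IsGaussianWhiteNoise W μ) (k : ℕ) (u : U) (y : E) :
    MemLp (fun ω => hermiteFun k (W u ω) • y) 2 μ :=
  (ContinuousLinearMap.toSpanSingleton ℝ y).comp_memLp' (hW.memLp_hermiteFun k u (by simp))

/-- The Hermite functional `Heₖ(W u) y` as an element of `L²`. -/
noncomputable def hermiteLp (hW : IsGaussianWhiteNoise W μ) (k : ℕ) (u : U) (y : E) :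
    Lp E 2 μ := (hW.memLp_hermiteFun_smul k u y).toLp _

lemma coeFn_hermiteLp (hW : IsGaussianWhiteNoise W μ) (k : ℕ) (u : U) (y : E) :
    hW.hermiteLp k u y =ᵐ[μ] fun ω => hermiteFun k (W u ω) • y :=
  MemLp.coeFn_toLp _

lemma hermiteLp_zero (hW : IsGaussianWhiteNoise W μ) [IsFiniteMeasure μ] (u : U) (y : E) :
    hW.hermiteLp 0 u y = Lp.const 2 μ y := by
  refine Lp.ext ?_
  filter_upwards [hW.coeFn_hermiteLp 0 u y, Lp.coeFn_const (p := 2) (μ := μ) y] with ω h1 h2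
  rw [h1, h2]
  simp

lemma inner_hermiteLp_right (hW : IsGaussianWhiteNoise W μ) (g : Lp E 2 μ) (k : ℕ) (u : U)
    (y : E) : ⟪g, hW.hermiteLp k u y⟫_ℝ = ∫ ω, ⟪g ω, y⟫_ℝ * hermiteFun k (W u ω) ∂μ := by
  rw [L2.inner_def]
  refine integral_congr_ae ?_
  filter_upwards [hW.coeFn_hermiteLp k u y] with ω h1
  rw [h1, inner_smul_right, mul_comm]

/-- In equal degrees this is `k!` times the inner product of `x ⊗ u^{⊗k}` and `y ⊗ v^{⊗k}`, the
source of the isometry between tensors and chaoses. -/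
lemma inner_hermiteLp (hW : IsGaussianWhiteNoise W μ) {u v : U} (hu : ‖u‖ = 1) (hv : ‖v‖ = 1)
    (j k : ℕ) (x y : E) : ⟪hW.hermiteLp j u x, hW.hermiteLp k v y⟫_ℝ =
      if j = k then (k.factorial : ℝ) * (⟪x, y⟫_ℝ * ⟪u, v⟫_ℝ ^ k) else 0 := by
  rw [inner_hermiteLp_right]
  have : ∫ ω, ⟪hW.hermiteLp j u x ω, y⟫_ℝ * hermiteFun k (W v ω) ∂μ =
      ∫ ω, ⟪x, y⟫_ℝ * (hermiteFun j (W u ω) * hermiteFun k (W v ω)) ∂μ := by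
    refine integral_congr_ae ?_
    filter_upwards [hW.coeFn_hermiteLp j u x] with ω h1
    rw [h1, real_inner_smul_left]
    ring
  rw [this, integral_const_mul, hW.integral_hermiteFun_mul hu hv]
  split_ifs
  · ring
  · simp

lemma inner_const_Lp [IsFiniteMeasure μ] [CompleteSpace E] (g : Lp E 2 μ) (y : E) :
    ⟪g, Lp.const 2 μ y⟫_ℝ = ⟪∫ ω, g ω ∂μ, y⟫_ℝ := by
  rw [real_inner_comm y, ← integral_inner ((Lp.memLp g).integrable (by norm_num)), L2.inner_def]
  refine integral_congr_ae ?_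
  filter_upwards [Lp.coeFn_const (p := 2) (μ := μ) y] with ω h1
  rw [h1]
  simp [real_inner_comm]

/-- Constants and Hermite functionals are total in `L²`. -/
lemma Lp_eq_zero_of_inner_hermiteLp [IsFiniteMeasure μ] [CompleteSpace E]
    (hW : IsGaussianWhiteNoise W μ) (g : Lp E 2 μ) (h₀ : ∀ y : E, ⟪g, Lp.const 2 μ y⟫_ℝ = 0)
    (h : ∀ (y : E) (u : U) (k : ℕ), ‖u‖ = 1 → ⟪g, hW.hermiteLp (k + 1) u y⟫_ℝ = 0) : g = 0 := by
  refine hW.Lp_eq_zero_of_forall_integral_pow g fun y =>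
    hW.integral_mul_pow_eq_zero ((Lp.memLp g).inner_const y) ?_ fun u k hu => ?_
  · rw [← h₀ y, inner_const_Lp, real_inner_comm,
      ← integral_inner ((Lp.memLp g).integrable (by norm_num))]
    simp only [real_inner_comm]
  · rw [← hW.inner_hermiteLp_right]
    exact h y u k hu

end IsGaussianWhiteNoise

/-! ### The duality relation and the Skorokhod integral -/

section Skorokhod

variable {Ω : Type*} [MeasurableSpace Ω] {μ : Measure Ω} {U : Type v} [NormedAddCommGroup U]
  [InnerProductSpace ℝ U] {W : U → Ω → ℝ}
  {E : Type u} [NormedAddCommGroup E] [InnerProductSpace ℝ E]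

lemma integral_mul_inner_eq (g : Lp E 2 μ) (φ : Lp ℝ 2 μ) (y : E) :
    ∫ ω, φ ω * ⟪g ω, y⟫_ℝ ∂μ =
      ⟪g, (ContinuousLinearMap.toSpanSingleton ℝ y).compLpL 2 μ φ⟫_ℝ := by
  rw [L2.inner_def]
  refine integral_congr_ae ?_
  filter_upwards [(ContinuousLinearMap.toSpanSingleton ℝ y).coeFn_compLpL φ] with ω h
  rw [h, ContinuousLinearMap.toSpanSingleton_apply, inner_smul_right]

lemma integral_inner_htmul_eq (f : Lp (HilbertTensor E U) 2 μ) (G : Lp U 2 μ) (y : E) :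
    ∫ ω, ⟪f ω, htmul y (G ω)⟫_ℝ ∂μ = ⟪f, (htmulCLM U y).compLpL 2 μ G⟫_ℝ := by
  rw [L2.inner_def]
  refine integral_congr_ae ?_
  filter_upwards [(htmulCLM U y).coeFn_compLpL G] with ω h
  rw [h, htmulCLM_apply]

/-- Both sides are `L²` inner products with bounded linear images of `φ` and `D φ`, hence
continuous, so the relation passes from smooth functionals to the closure of the graph. -/
lemma skorokhodDuality_iff {f : Lp (HilbertTensor E U) 2 μ} {g : Lp E 2 μ} :
    SkorokhodDuality W μ f g ↔ ∀ p ∈ smoothMalliavinGraph W μ, ∀ y : E,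
      ⟪g, (ContinuousLinearMap.toSpanSingleton ℝ y).compLpL 2 μ p.1⟫_ℝ =
        ⟪f, (htmulCLM U y).compLpL 2 μ p.2⟫_ℝ := by
  simp only [SkorokhodDuality, integral_mul_inner_eq, integral_inner_htmul_eq]
  refine ⟨fun h p hp => h p.1 p.2 (subset_closure hp), fun h φ G hφ y => ?_⟩
  have hclosed : IsClosed {p : Lp ℝ 2 μ × Lp U 2 μ |
      ⟪g, (ContinuousLinearMap.toSpanSingleton ℝ y).compLpL 2 μ p.1⟫_ℝ =
        ⟪f, (htmulCLM U y).compLpL 2 μ p.2⟫_ℝ} :=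
    isClosed_eq (by fun_prop) (by fun_prop)
  exact closure_minimal (fun p hp => h p hp y) hclosed hφ

lemma SkorokhodDuality.zero :
    SkorokhodDuality W μ (0 : Lp (HilbertTensor E U) 2 μ) (0 : Lp E 2 μ) := by
  simp [skorokhodDuality_iff]

lemma SkorokhodDuality.add {f f' : Lp (HilbertTensor E U) 2 μ} {g g' : Lp E 2 μ}
    (h : SkorokhodDuality W μ f g) (h' : SkorokhodDuality W μ f' g') :
    SkorokhodDuality W μ (f + f') (g + g') := by
  rw [skorokhodDuality_iff] at *
  intro p hp y
  rw [inner_add_left, inner_add_left, h p hp y, h' p hp y]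

lemma SkorokhodDuality.smul {f : Lp (HilbertTensor E U) 2 μ} {g : Lp E 2 μ} (c : ℝ)
    (h : SkorokhodDuality W μ f g) : SkorokhodDuality W μ (c • f) (c • g) := by
  rw [skorokhodDuality_iff] at *
  intro p hp y
  rw [real_inner_smul_left, real_inner_smul_left, h p hp y]

/-- The Skorokhod integral is a closed operator, because it is defined by duality. -/
lemma SkorokhodDuality.of_tendsto {f : ℕ → Lp (HilbertTensor E U) 2 μ} {g : ℕ → Lp E 2 μ}
    {f₀ : Lp (HilbertTensor E U) 2 μ} {g₀ : Lp E 2 μ}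
    (h : ∀ n, SkorokhodDuality W μ (f n) (g n)) (hf : Filter.Tendsto f Filter.atTop (nhds f₀))
    (hg : Filter.Tendsto g Filter.atTop (nhds g₀)) : SkorokhodDuality W μ f₀ g₀ := by
  simp only [skorokhodDuality_iff] at *
  intro p hp y
  exact tendsto_nhds_unique (hg.inner tendsto_const_nhds)
    ((hf.inner tendsto_const_nhds).congr fun n => (h n p hp y).symm)

lemma exists_mem_smoothMalliavinGraph (hW : IsGaussianWhiteNoise W μ) {n : ℕ} (h : Fin n → U)
    {F : (Fin n → ℝ) → ℝ} (hF : F.HasTemperateGrowth) :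
    ∃ p ∈ smoothMalliavinGraph W μ, p.1 =ᵐ[μ] fun ω => F (fun i => W (h i) ω) := by
  have := hW.isProbabilityMeasure
  have h1 : MemLp (fun ω => F (fun i => W (h i) ω)) 2 μ :=
    memLp_comp_of_hasTemperateGrowth hF (fun p hp => hW.memLp_pi h hp) (by simp)
  have h2 : MemLp (fun ω => ∑ i, fderiv ℝ F (fun j => W (h j) ω) (Pi.single i 1) • h i) 2 μ := by
    refine memLp_finsetSum _ fun i _ => ?_
    let A : ((Fin n → ℝ) →L[ℝ] ℝ) →L[ℝ] U := (ContinuousLinearMap.toSpanSingleton ℝ (h i)).comp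
      (ContinuousLinearMap.apply ℝ ℝ (Pi.single i 1))
    have hT : (fun x => fderiv ℝ F x (Pi.single i 1) • h i).HasTemperateGrowth :=
      A.hasTemperateGrowth.comp (hasTemperateGrowth_fderiv hF)
    exact memLp_comp_of_hasTemperateGrowth hT (fun p hp => hW.memLp_pi h hp) (by simp)
  exact ⟨(h1.toLp _, h2.toLp _), ⟨n, h, F, hF, h1.coeFn_toLp, h2.coeFn_toLp⟩, h1.coeFn_toLp⟩

/-- The difference of two candidates is dual to `0`; testing with the smooth functionals `W(u)^n`
makes it orthogonal to a total set. -/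
lemma SkorokhodDuality.unique [CompleteSpace E] (hW : IsGaussianWhiteNoise W μ)
    {f : Lp (HilbertTensor E U) 2 μ} {g g' : Lp E 2 μ} (h : SkorokhodDuality W μ f g)
    (h' : SkorokhodDuality W μ f g') : g' = g := by
  rw [← sub_eq_zero]
  refine hW.Lp_eq_zero_of_forall_integral_pow _ fun y u n => ?_
  obtain ⟨p, hp, hp1⟩ := exists_mem_smoothMalliavinGraph hW (fun _ : Fin 1 => u)
    (F := fun x => x 0 ^ n)
    ((ContinuousLinearMap.proj (R := ℝ) (φ := fun _ : Fin 1 => ℝ) 0).hasTemperateGrowth.pow n)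
  have hsub := h'.add (h.smul (-1))
  rw [neg_one_smul, neg_one_smul, ← sub_eq_add_neg, ← sub_eq_add_neg, sub_self] at hsub
  have := hsub p.1 p.2 (subset_closure hp) y
  rw [integral_inner_htmul_eq, inner_zero_left] at this
  rw [← this]
  refine integral_congr_ae ?_
  filter_upwards [hp1] with ω hω
  rw [hω, mul_comm]

lemma SkorokhodDuality.hasSkorokhodIntegral [CompleteSpace E] (hW : IsGaussianWhiteNoise W μ)
    {f : Lp (HilbertTensor E U) 2 μ} {g : Lp E 2 μ} (h : SkorokhodDuality W μ f g) :
    HasSkorokhodIntegral W μ f g :=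
  ⟨h, fun _ h' => h.unique hW h'⟩

/-- The Skorokhod integral raises the degree of a Hermite functional. -/
lemma skorokhodDuality_hermiteLp (hW : IsGaussianWhiteNoise W μ) {u : U} (hu : ‖u‖ = 1) (k : ℕ)
    (y : E) :
    SkorokhodDuality W μ (hW.hermiteLp k u (htmul y u)) (hW.hermiteLp (k + 1) u y) := by
  rw [skorokhodDuality_iff]
  rintro ⟨φ, G⟩ ⟨n, h, F, hF, hφ, hG⟩ z
  rw [← integral_mul_inner_eq, ← integral_inner_htmul_eq]
  have h1 : ∫ ω, φ ω * ⟪hW.hermiteLp (k + 1) u y ω, z⟫_ℝ ∂μ =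
      ∫ ω, ⟪y, z⟫_ℝ * (hermiteFun (k + 1) (W u ω) * F (fun i => W (h i) ω)) ∂μ := by
    refine integral_congr_ae ?_
    filter_upwards [hφ, hW.coeFn_hermiteLp (k + 1) u y] with ω e1 e2
    rw [e1, e2, real_inner_smul_left]
    ring
  have h2 : ∫ ω, ⟪hW.hermiteLp k u (htmul y u) ω, htmul z (G ω)⟫_ℝ ∂μ =
      ∫ ω, ⟪y, z⟫_ℝ * (hermiteFun k (W u ω) *
        fderiv ℝ F (fun i => W (h i) ω) (fun i => ⟪u, h i⟫_ℝ)) ∂μ := by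
    refine integral_congr_ae ?_
    filter_upwards [hG, hW.coeFn_hermiteLp k u (htmul y u)] with ω e1 e2
    -- The derivative in the direction `(⟪u, h i⟫)` is `⟪u, D φ⟫`, so Gaussian integration by parts
    -- is the duality relation.
    have e3 : fderiv ℝ F (fun i => W (h i) ω) (fun i => ⟪u, h i⟫_ℝ) =
        ∑ i, ⟪u, fderiv ℝ F (fun j => W (h j) ω) (Pi.single i 1) • h i⟫_ℝ := by
      rw [← Finset.univ_sum_single fun i => ⟪u, h i⟫_ℝ, map_sum]
      refine Finset.sum_congr rfl fun i _ => ?_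
      have : (Pi.single i ⟪u, h i⟫_ℝ : Fin n → ℝ) = ⟪u, h i⟫_ℝ • Pi.single i 1 := by
        rw [← Pi.single_smul, smul_eq_mul, mul_one]
      rw [this, map_smul, smul_eq_mul, inner_smul_right, mul_comm]
    rw [e1, e2, e3, real_inner_smul_left, inner_htmul, inner_sum, mul_left_comm]
  rw [h1, h2, integral_const_mul, integral_const_mul, hW.integral_hermiteFun_succ_mul hu h k hF]

end Skorokhod

/-! ### Families of vectors with proportional Gram matrices -/

section LinearCombination

variable {P A B A' B' : Type*} [NormedAddCommGroup A] [InnerProductSpace ℝ A]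
  [NormedAddCommGroup B] [InnerProductSpace ℝ B]

/-- Formal combinations in `P →₀ ℝ` carry relations from one family to the other without a linear
map on spans, whose well-definedness would need proof. -/
lemma inner_linearCombination {v v' : P → A} {w w' : P → B} {c : ℝ}
    (h : ∀ p q, ⟪v p, v' q⟫_ℝ = c * ⟪w p, w' q⟫_ℝ) (d e : P →₀ ℝ) :
    ⟪Finsupp.linearCombination ℝ v d, Finsupp.linearCombination ℝ v' e⟫_ℝ =
      c * ⟪Finsupp.linearCombination ℝ w d, Finsupp.linearCombination ℝ w' e⟫_ℝ := by
  induction d using Finsupp.induction_linear with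
  | zero => simp
  | add d₁ d₂ h₁ h₂ => simp only [map_add, inner_add_left, h₁, h₂, mul_add]
  | single p a =>
    induction e using Finsupp.induction_linear with
    | zero => simp
    | add e₁ e₂ h₁ h₂ => simp only [map_add, inner_add_right, h₁, h₂, mul_add]
    | single q b =>
      simp only [Finsupp.linearCombination_single, real_inner_smul_left, real_inner_smul_right, h]
      ring

lemma norm_sq_linearCombination {v : P → A} {w : P → B} {c : ℝ}
    (h : ∀ p q, ⟪v p, v q⟫_ℝ = c * ⟪w p, w q⟫_ℝ) (d : P →₀ ℝ) :
    ‖Finsupp.linearCombination ℝ v d‖ ^ 2 = c * ‖Finsupp.linearCombination ℝ w d‖ ^ 2 := by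
  rw [← real_inner_self_eq_norm_sq, ← real_inner_self_eq_norm_sq, inner_linearCombination h]

/-- If the Gram matrices of two families are proportional, then linear combinations of the first
family converge whenever the corresponding combinations of the second family do. -/
lemma exists_tendsto_linearCombination [CompleteSpace A] {v : P → A} {w : P → B} {c : ℝ}
    (h : ∀ p q, ⟪v p, v q⟫_ℝ = c * ⟪w p, w q⟫_ℝ) {d : ℕ → P →₀ ℝ} {b : B}
    (hb : Filter.Tendsto (fun j => Finsupp.linearCombination ℝ w (d j)) Filter.atTop (nhds b)) :
    ∃ a, Filter.Tendsto (fun j => Finsupp.linearCombination ℝ v (d j)) Filter.atTop (nhds a) := by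
  refine cauchySeq_tendsto_of_complete ?_
  have hc := cauchySeq_iff_tendsto_dist_atTop_0.1 hb.cauchySeq
  rw [cauchySeq_iff_tendsto_dist_atTop_0]
  have key : ∀ n : ℕ × ℕ, dist (Finsupp.linearCombination ℝ v (d n.1))
      (Finsupp.linearCombination ℝ v (d n.2)) = √(c *
        dist (Finsupp.linearCombination ℝ w (d n.1)) (Finsupp.linearCombination ℝ w (d n.2)) ^ 2) := by
    intro n
    rw [dist_eq_norm, dist_eq_norm, ← map_sub, ← map_sub, ← norm_sq_linearCombination h,
      Real.sqrt_sq (norm_nonneg _)]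
  simp only [key]
  simpa using ((hc.pow 2).const_mul c).sqrt

lemma exists_seq_tendsto_of_mem_closure_span {v : P → A} {a : A}
    (ha : a ∈ (Submodule.span ℝ (Set.range v)).topologicalClosure) :
    ∃ d : ℕ → P →₀ ℝ,
      Filter.Tendsto (fun j => Finsupp.linearCombination ℝ v (d j)) Filter.atTop (nhds a) := by
  rw [← SetLike.mem_coe, Submodule.topologicalClosure_coe, mem_closure_iff_seq_limit] at ha
  obtain ⟨x, hx, hlim⟩ := ha
  have : ∀ j, ∃ d : P →₀ ℝ, Finsupp.linearCombination ℝ v d = x j := fun j => by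
    have hj := hx j
    rw [← Finsupp.range_linearCombination] at hj
    exact hj
  choose d hd using this
  exact ⟨d, by simpa only [hd] using hlim⟩

lemma mem_closure_span_of_tendsto {v : P → A} {a : A} {d : ℕ → P →₀ ℝ}
    (h : Filter.Tendsto (fun j => Finsupp.linearCombination ℝ v (d j)) Filter.atTop (nhds a)) :
    a ∈ (Submodule.span ℝ (Set.range v)).topologicalClosure := by
  refine mem_closure_of_tendsto h (Filter.Eventually.of_forall fun j => ?_)
  rw [← Finsupp.range_linearCombination]
  exact LinearMap.mem_range_self _ _

end LinearCombination

/-! ### Multiple Skorokhod integrals of symmetric tensors -/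

section Chaos

variable {Ω : Type*} [MeasurableSpace Ω] {μ : Measure Ω} {U : Type v} [NormedAddCommGroup U]
  [InnerProductSpace ℝ U] {W : U → Ω → ℝ}
  {X : Type u} [NormedAddCommGroup X] [InnerProductSpace ℝ X]

lemma HasMultipleSkorokhodIntegral.unique {n : ℕ} {f : Lp (TensorPow X U n) 2 μ} {g g' : Lp X 2 μ}
    (h : HasMultipleSkorokhodIntegral W μ n f g) (h' : HasMultipleSkorokhodIntegral W μ n f g') :
    g = g' := by
  induction n with
  | zero => exact h'.2 g h.1
  | succ n ih =>
    obtain ⟨k, hk, hg⟩ := h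
    obtain ⟨k', hk', hg'⟩ := h'
    obtain rfl : k = k' := hk'.2 k hk.1
    exact ih hg hg'

lemma skorokhodDuality_linearCombination (hW : IsGaussianWhiteNoise W μ) {P : Type*}
    {E : Type u} [NormedAddCommGroup E] [InnerProductSpace ℝ E] (y : P → E)
    (u : P → Metric.sphere (0 : U) 1) (k : ℕ) (d : P →₀ ℝ) :
    SkorokhodDuality W μ
      (Finsupp.linearCombination ℝ (fun p => hW.hermiteLp k (u p : U) (htmul (y p) (u p : U))) d)
      (Finsupp.linearCombination ℝ (fun p => hW.hermiteLp (k + 1) (u p : U) (y p)) d) := by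
  induction d using Finsupp.induction_linear with
  | zero => simpa using SkorokhodDuality.zero
  | add d₁ d₂ h₁ h₂ => simpa only [map_add] using h₁.add h₂
  | single p a =>
    simp only [Finsupp.linearCombination_single]
    exact (skorokhodDuality_hermiteLp hW (norm_eq_of_mem_sphere (u p)) k (y p)).smul a

/-- Apart from `k!` only the sum `k + n` enters. A step of the iterated integral raises `k` and
lowers `n` by one, so it multiplies the Gram matrix by `k + 1`. -/
lemma inner_hermiteLp_diagTensor (hW : IsGaussianWhiteNoise W μ) (k n : ℕ)
    (p q : X × Metric.sphere (0 : U) 1) :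
    ⟪hW.hermiteLp k (p.2 : U) (diagTensor n p.1 (p.2 : U)),
      hW.hermiteLp k (q.2 : U) (diagTensor n q.1 (q.2 : U))⟫_ℝ =
      (k.factorial : ℝ) * (⟪p.1, q.1⟫_ℝ * ⟪(p.2 : U), (q.2 : U)⟫_ℝ ^ (k + n + 1)) := by
  rw [hW.inner_hermiteLp (norm_eq_of_mem_sphere p.2) (norm_eq_of_mem_sphere q.2), if_pos rfl,
    inner_diagTensor]
  ring

/-- The multiple Skorokhod integrals of `L²`-limits of linear combinations of Hermite functionals
with diagonal tensors as coefficients. -/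
lemma hasMultipleSkorokhodIntegral_of_tendsto [CompleteSpace X] (hW : IsGaussianWhiteNoise W μ)
    (n k : ℕ) {d : ℕ → X × Metric.sphere (0 : U) 1 →₀ ℝ} {f : Lp (TensorPow X U n) 2 μ}
    {g : Lp X 2 μ}
    (hf : Filter.Tendsto (fun j => Finsupp.linearCombination ℝ
      (fun p : X × Metric.sphere (0 : U) 1 =>
        hW.hermiteLp k (p.2 : U) (diagTensor n p.1 (p.2 : U))) (d j)) Filter.atTop (nhds f))
    (hg : Filter.Tendsto (fun j => Finsupp.linearCombination ℝ
      (fun p : X × Metric.sphere (0 : U) 1 =>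
        hW.hermiteLp (k + n + 1) (p.2 : U) p.1) (d j)) Filter.atTop (nhds g)) :
    HasMultipleSkorokhodIntegral W μ n f g := by
  induction n generalizing k with
  | zero =>
    exact (SkorokhodDuality.of_tendsto (fun j => skorokhodDuality_linearCombination hW
      (fun p : X × Metric.sphere (0 : U) 1 => p.1) (fun p => p.2) k (d j)) hf
      hg).hasSkorokhodIntegral hW
  | succ n ih =>
    -- The intermediate integral is the limit of the same combinations with the Hermite degree
    -- raised and one tensor factor removed; this is why `k` is general in the induction.
    obtain ⟨h, hh⟩ := exists_tendsto_linearCombination (c := k + 1)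
      (v := fun p : X × Metric.sphere (0 : U) 1 =>
        hW.hermiteLp (k + 1) (p.2 : U) (diagTensor n p.1 (p.2 : U)))
      (fun p q => by
        rw [inner_hermiteLp_diagTensor, inner_hermiteLp_diagTensor, Nat.factorial_succ]
        push_cast
        ring) hf
    refine ⟨h, (SkorokhodDuality.of_tendsto (fun j => skorokhodDuality_linearCombination hW
      (fun p : X × Metric.sphere (0 : U) 1 => diagTensor n p.1 (p.2 : U)) (fun p => p.2) k (d j))
      hf hh).hasSkorokhodIntegral hW, ih (k + 1) hh ?_⟩
    rwa [show k + 1 + n + 1 = k + (n + 1) + 1 by ring]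

/-- `ChaosPair hW n z g`: the coefficient `z` and the random element `g` are limits of
corresponding linear combinations of diagonal tensors and of Hermite functionals. -/
def ChaosPair (hW : IsGaussianWhiteNoise W μ) (n : ℕ) (z : TensorPow X U n) (g : Lp X 2 μ) : Prop :=
  ∃ d : ℕ → X × Metric.sphere (0 : U) 1 →₀ ℝ,
    Filter.Tendsto (fun j => Finsupp.linearCombination ℝ
      (fun p : X × Metric.sphere (0 : U) 1 => diagTensor n p.1 (p.2 : U)) (d j))
      Filter.atTop (nhds z) ∧
    Filter.Tendsto (fun j => Finsupp.linearCombination ℝ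
      (fun p : X × Metric.sphere (0 : U) 1 => hW.hermiteLp (n + 1) (p.2 : U) p.1) (d j))
      Filter.atTop (nhds g)

lemma inner_hermiteLp_eq_inner_diagTensor (hW : IsGaussianWhiteNoise W μ) (n : ℕ)
    (p q : X × Metric.sphere (0 : U) 1) :
    ⟪hW.hermiteLp (n + 1) (p.2 : U) p.1, hW.hermiteLp (n + 1) (q.2 : U) q.1⟫_ℝ =
      ((n + 1).factorial : ℝ) *
        ⟪diagTensor n p.1 (p.2 : U), diagTensor n q.1 (q.2 : U)⟫_ℝ := by
  rw [hW.inner_hermiteLp (norm_eq_of_mem_sphere p.2) (norm_eq_of_mem_sphere q.2), if_pos rfl,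
    inner_diagTensor]

/-- Together with the next lemma, this gives both directions of the correspondence between symmetric
tensors and a chaos: convergence on one side forces it on the other, by the factor `(n+1)!` between
the Gram matrices. -/
lemma exists_chaosPair_of_mem_symTensorPow [CompleteSpace X] (hW : IsGaussianWhiteNoise W μ)
    {n : ℕ} {z : TensorPow X U n} (hz : z ∈ symTensorPow X U n) :
    ∃ g : Lp X 2 μ, ChaosPair hW n z g := by
  rw [symTensorPow_eq_closure_span] at hz
  obtain ⟨d, hd⟩ := exists_seq_tendsto_of_mem_closure_span hz
  obtain ⟨g, hg⟩ := exists_tendsto_linearCombination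
    (inner_hermiteLp_eq_inner_diagTensor (μ := μ) hW n) hd
  exact ⟨g, d, hd, hg⟩

lemma exists_chaosPair_of_mem_closure (hW : IsGaussianWhiteNoise W μ) {n : ℕ} {g : Lp X 2 μ}
    (hg : g ∈ (Submodule.span ℝ (Set.range fun p : X × Metric.sphere (0 : U) 1 =>
      hW.hermiteLp (n + 1) (p.2 : U) p.1)).topologicalClosure) :
    ∃ z ∈ symTensorPow X U n, ChaosPair hW n z g := by
  obtain ⟨d, hd⟩ := exists_seq_tendsto_of_mem_closure_span hg
  obtain ⟨z, hz⟩ := exists_tendsto_linearCombination (c := ((n + 1).factorial : ℝ)⁻¹)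
    (v := fun p : X × Metric.sphere (0 : U) 1 => diagTensor n p.1 (p.2 : U)) (fun p q => by
      rw [inner_hermiteLp_eq_inner_diagTensor, ← mul_assoc,
        inv_mul_cancel₀ (Nat.cast_ne_zero.2 (Nat.factorial_ne_zero _)), one_mul]) hd
  refine ⟨z, ?_, d, hz, hd⟩
  rw [symTensorPow_eq_closure_span]
  exact mem_closure_span_of_tendsto hz

namespace ChaosPair

variable {hW : IsGaussianWhiteNoise W μ} {n m : ℕ} {z : TensorPow X U n} {g g' : Lp X 2 μ}
  {z' : TensorPow X U m}

lemma smul (h : ChaosPair hW n z g) (c : ℝ) : ChaosPair hW n (c • z) (c • g) := by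
  obtain ⟨d, h1, h2⟩ := h
  exact ⟨fun j => c • d j, by simpa using h1.const_smul c, by simpa using h2.const_smul c⟩

lemma hasMultipleSkorokhodIntegral [CompleteSpace X] [IsFiniteMeasure μ]
    (h : ChaosPair hW n z g) : HasMultipleSkorokhodIntegral W μ n (Lp.const 2 μ z) g := by
  obtain ⟨d, h1, h2⟩ := h
  -- Degree `0` is the starting point: `He_0 = 1`, so the integrand is deterministic.
  refine hasMultipleSkorokhodIntegral_of_tendsto hW n 0 (d := d) ?_ (by rwa [Nat.zero_add])
  have h3 := ((Lp.constL 2 μ ℝ : TensorPow X U n →L[ℝ] _).continuous.tendsto z).comp h1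
  refine h3.congr fun j => ?_
  simp only [hW.hermiteLp_zero]
  exact Finsupp.apply_linearCombination ℝ
    (Lp.constL 2 μ ℝ : TensorPow X U n →L[ℝ] Lp (TensorPow X U n) 2 μ).toLinearMap _ _

lemma norm_sq (h : ChaosPair hW n z g) : ‖g‖ ^ 2 = ((n + 1).factorial : ℝ) * ‖z‖ ^ 2 := by
  obtain ⟨d, h1, h2⟩ := h
  exact tendsto_nhds_unique (h2.norm.pow 2) (((h1.norm.pow 2).const_mul _).congr fun j =>
    (norm_sq_linearCombination (inner_hermiteLp_eq_inner_diagTensor hW n) (d j)).symm)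

lemma inner_hermiteLp (h : ChaosPair hW n z g) (x : X) (u : Metric.sphere (0 : U) 1) :
    ⟪g, hW.hermiteLp (n + 1) (u : U) x⟫_ℝ =
      ((n + 1).factorial : ℝ) * ⟪z, diagTensor n x (u : U)⟫_ℝ := by
  obtain ⟨d, h1, h2⟩ := h
  refine tendsto_nhds_unique (h2.inner tendsto_const_nhds)
    (((h1.inner tendsto_const_nhds).const_mul _).congr fun j => ?_)
  simpa using
    (inner_linearCombination (inner_hermiteLp_eq_inner_diagTensor hW n) (d j)
      (Finsupp.single (x, u) 1)).symm

lemma inner_eq_zero_of_forall {y : Lp X 2 μ} (h : ChaosPair hW n z g)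
    (hy : ∀ (x : X) (u : U), ‖u‖ = 1 → ⟪hW.hermiteLp (n + 1) u x, y⟫_ℝ = 0) : ⟪g, y⟫_ℝ = 0 := by
  obtain ⟨d, -, h2⟩ := h
  refine tendsto_nhds_unique (h2.inner tendsto_const_nhds)
    (tendsto_const_nhds.congr fun j => Eq.symm ?_)
  rw [Finsupp.linearCombination_apply, Finsupp.sum, sum_inner]
  refine Finset.sum_eq_zero fun p _ => ?_
  rw [real_inner_smul_left, hy _ _ (norm_eq_of_mem_sphere p.2), mul_zero]

lemma inner_hermiteLp_of_ne (h : ChaosPair hW n z g) {k : ℕ} (hk : n + 1 ≠ k) (x : X) {u : U}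
    (hu : ‖u‖ = 1) : ⟪g, hW.hermiteLp k u x⟫_ℝ = 0 :=
  h.inner_eq_zero_of_forall fun y v hv => by rw [hW.inner_hermiteLp hv hu, if_neg hk]

lemma inner_of_ne (h : ChaosPair hW n z g) (h' : ChaosPair hW m z' g') (hne : n ≠ m) :
    ⟪g, g'⟫_ℝ = 0 :=
  h.inner_eq_zero_of_forall fun y v hv => by
    rw [real_inner_comm]
    exact h'.inner_hermiteLp_of_ne (by simpa using hne.symm) y hv

end ChaosPair

lemma inner_hermiteLp_const [IsFiniteMeasure μ] [CompleteSpace X] (hW : IsGaussianWhiteNoise W μ)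
    {u : U} (hu : ‖u‖ = 1) (k : ℕ) (x y : X) :
    ⟪hW.hermiteLp (k + 1) u x, Lp.const 2 μ y⟫_ℝ = 0 := by
  rw [← hW.hermiteLp_zero u y, hW.inner_hermiteLp hu hu, if_neg k.succ_ne_zero]

end Chaos

/-! ### Chaos decomposition, uniqueness and Parseval's identity -/

section Expansion

variable {Ω : Type*} [MeasurableSpace Ω] {μ : Measure Ω} [IsProbabilityMeasure μ] {U : Type v}
  [NormedAddCommGroup U] [InnerProductSpace ℝ U] {W : U → Ω → ℝ}
  {X : Type u} [NormedAddCommGroup X] [InnerProductSpace ℝ X] [CompleteSpace X]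

/-- The homogeneous chaos of degree `n` in `L²(X)`. -/
noncomputable def chaos (X : Type u) [NormedAddCommGroup X] [InnerProductSpace ℝ X]
    (hW : IsGaussianWhiteNoise W μ) : ℕ → Submodule ℝ (Lp X 2 μ)
  | 0 => (Submodule.span ℝ (Set.range fun y : X => Lp.const 2 μ y)).topologicalClosure
  | n + 1 => (Submodule.span ℝ (Set.range fun p : X × Metric.sphere (0 : U) 1 =>
      hW.hermiteLp (n + 1) (p.2 : U) p.1)).topologicalClosure

instance (hW : IsGaussianWhiteNoise W μ) (n : ℕ) : CompleteSpace (chaos X hW n) := by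
  cases n <;> exact (Submodule.isClosed_topologicalClosure _).completeSpace_coe

lemma isometry_const {Y : Type*} [NormedAddCommGroup Y] :
    Isometry fun y : Y => Lp.const 2 μ y :=
  AddMonoidHomClass.isometry_of_norm (Lp.const 2 μ) fun y => by
    refine (Lp.norm_const _ _ _ (by norm_num)).trans ?_
    simp

lemma exists_const_eq_of_mem_chaos_zero (hW : IsGaussianWhiteNoise W μ) {g : Lp X 2 μ}
    (hg : g ∈ chaos X hW 0) : ∃ y : X, Lp.const 2 μ y = g := by
  -- The constants are an isometric image of the complete space `X`, hence already closed.
  have hle : chaos X hW 0 ≤ LinearMap.range (Lp.constₗ 2 μ ℝ : X →ₗ[ℝ] Lp X 2 μ) := by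
    refine Submodule.topologicalClosure_minimal _ (Submodule.span_le.2 ?_)
      (isometry_const (μ := μ) (Y := X)).isClosedEmbedding.isClosed_range
    rintro _ ⟨y, rfl⟩
    exact ⟨y, rfl⟩
  exact hle hg

lemma isOrtho_topologicalClosure {H : Type*} [NormedAddCommGroup H] [InnerProductSpace ℝ H]
    {K L : Submodule ℝ H} (h : K ⟂ L) : K.topologicalClosure ⟂ L.topologicalClosure := by
  rw [Submodule.isOrtho_iff_le, Submodule.orthogonal_closure]
  exact Submodule.topologicalClosure_minimal _ h (Submodule.isClosed_orthogonal _)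

lemma pairwise_isOrtho_chaos (hW : IsGaussianWhiteNoise W μ) :
    Pairwise fun m n => chaos X hW m ⟂ chaos X hW n := by
  intro m n hmn
  cases m with
  | zero =>
    cases n with
    | zero => exact absurd rfl hmn
    | succ n =>
      refine isOrtho_topologicalClosure (Submodule.isOrtho_span.2 ?_)
      rintro _ ⟨y, rfl⟩ _ ⟨p, rfl⟩
      rw [real_inner_comm]
      exact inner_hermiteLp_const hW (norm_eq_of_mem_sphere p.2) n p.1 y
  | succ m =>
    cases n with
    | zero =>
      refine isOrtho_topologicalClosure (Submodule.isOrtho_span.2 ?_)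
      rintro _ ⟨p, rfl⟩ _ ⟨y, rfl⟩
      exact inner_hermiteLp_const hW (norm_eq_of_mem_sphere p.2) m p.1 y
    | succ n =>
      refine isOrtho_topologicalClosure (Submodule.isOrtho_span.2 ?_)
      rintro _ ⟨p, rfl⟩ _ ⟨q, rfl⟩
      rw [hW.inner_hermiteLp (norm_eq_of_mem_sphere p.2) (norm_eq_of_mem_sphere q.2), if_neg hmn]

/-- The Wiener chaos decomposition of `L²(X)`. -/
lemma isHilbertSum_chaos (hW : IsGaussianWhiteNoise W μ) :
    IsHilbertSum ℝ (fun n => chaos X hW n) fun n => (chaos X hW n).subtypeₗᵢ := by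
  refine IsHilbertSum.mkInternal _ (OrthogonalFamily.of_pairwise (pairwise_isOrtho_chaos hW)) ?_
  rw [top_le_iff, Submodule.topologicalClosure_eq_top_iff, Submodule.eq_bot_iff]
  intro g hg
  have hg' : ∀ n, ∀ f ∈ chaos X hW n, ⟪g, f⟫_ℝ = 0 := fun n f hf =>
    Submodule.inner_left_of_mem_orthogonal (Submodule.mem_iSup_of_mem n hf) hg
  refine hW.Lp_eq_zero_of_inner_hermiteLp g (fun y => hg' 0 _ ?_) fun y u k hu => hg' (k + 1) _ ?_
  · exact Submodule.le_topologicalClosure _ (Submodule.subset_span ⟨y, rfl⟩)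
  · exact Submodule.le_topologicalClosure _
      (Submodule.subset_span ⟨(y, ⟨u, mem_sphere_zero_iff_norm.2 hu⟩), rfl⟩)

theorem exists_isChaosExpansion (hW : IsGaussianWhiteNoise W μ) (η : Lp X 2 μ) :
    ∃ (z₀ : X) (z : (n : ℕ) → symTensorPow X U n), IsChaosExpansion W μ η z₀ z := by
  have hS := isHilbertSum_chaos (X := X) hW
  have hsum := hS.hasSum_linearIsometryEquiv_symm (hS.linearIsometryEquiv η)
  rw [LinearIsometryEquiv.symm_apply_apply] at hsum
  set w := hS.linearIsometryEquiv η
  obtain ⟨z₀, hz₀⟩ := exists_const_eq_of_mem_chaos_zero hW (w 0).2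
  have hex := fun n : ℕ => exists_chaosPair_of_mem_closure hW (n := n) (g := (w (n + 1) : Lp X 2 μ))
    (w (n + 1)).2
  choose z hz hpair using hex
  -- The component of degree `n + 1` is itself the integral of `z n`; the factorial cancels the `1 /
  -- k!` of the expansion.
  refine ⟨z₀, fun n => ((n + 1).factorial : ℝ) • ⟨z n, hz n⟩,
    fun n => ((n + 1).factorial : ℝ) • (w (n + 1) : Lp X 2 μ),
    fun n => ((hpair n).smul _).hasMultipleSkorokhodIntegral, ?_⟩
  rw [hz₀]
  have h1 := (hasSum_nat_add_iff' 1).2 hsum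
  simp only [Finset.range_one, Finset.sum_singleton] at h1
  have h2 : (fun n => (1 / ((n + 1).factorial : ℝ)) • ((n + 1).factorial : ℝ) •
      (w (n + 1) : Lp X 2 μ)) = fun n => (w (n + 1) : Lp X 2 μ) := by
    funext n
    rw [smul_smul, one_div, inv_mul_cancel₀ (Nat.cast_ne_zero.2 (Nat.factorial_ne_zero _)),
      one_smul]
  rw [h2]
  exact h1

/-- An arbitrary expansion has the same structure as the constructed one: each symmetric coefficient
has a partner in its chaos, and uniqueness of the multiple integral identifies it with the given
term. -/
lemma IsChaosExpansion.exists_chaosPair (hW : IsGaussianWhiteNoise W μ) {ζ : Lp X 2 μ} {z₀ : X}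
    {z : (n : ℕ) → symTensorPow X U n} (h : IsChaosExpansion W μ ζ z₀ z) :
    ∃ I : ℕ → Lp X 2 μ, (∀ n, ChaosPair hW n (z n : TensorPow X U n) (I n)) ∧
      HasSum (fun n => (1 / ((n + 1).factorial : ℝ)) • I n) (ζ - Lp.const 2 μ z₀) := by
  obtain ⟨I, hI, hsum⟩ := h
  refine ⟨I, fun n => ?_, hsum⟩
  obtain ⟨g, hg⟩ := exists_chaosPair_of_mem_symTensorPow hW (z n).2
  rwa [(hI n).unique hg.hasMultipleSkorokhodIntegral]

lemma hasSum_inner_left {ι H : Type*} [NormedAddCommGroup H] [InnerProductSpace ℝ H] {f : ι → H}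
    {a : H} (h : HasSum f a) (y : H) : HasSum (fun i => ⟪f i, y⟫_ℝ) ⟪a, y⟫_ℝ := by
  simpa only [innerSL_apply_apply, real_inner_comm] using h.mapL (innerSL ℝ y)

lemma IsChaosExpansion.inner_const (hW : IsGaussianWhiteNoise W μ) {ζ : Lp X 2 μ} {z₀ : X}
    {z : (n : ℕ) → symTensorPow X U n} (h : IsChaosExpansion W μ ζ z₀ z) (y : X) :
    ⟪ζ, Lp.const 2 μ y⟫_ℝ = ⟪Lp.const 2 μ z₀, Lp.const 2 μ y⟫_ℝ := by
  obtain ⟨I, hI, hsum⟩ := h.exists_chaosPair hW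
  have h1 := hasSum_inner_left hsum (Lp.const 2 μ y)
  have h2 : ∀ n, ⟪I n, Lp.const 2 μ y⟫_ℝ = 0 := fun n =>
    (hI n).inner_eq_zero_of_forall fun x u hu => inner_hermiteLp_const hW hu n x y
  simp only [real_inner_smul_left, h2, mul_zero] at h1
  rw [← sub_eq_zero, ← inner_sub_left]
  exact h1.unique hasSum_zero

/-- The constant term of a chaos expansion is the mean. -/
lemma IsChaosExpansion.eq_integral (hW : IsGaussianWhiteNoise W μ) {ζ : Lp X 2 μ} {z₀ : X}
    {z : (n : ℕ) → symTensorPow X U n} (h : IsChaosExpansion W μ ζ z₀ z) :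
    z₀ = ∫ ω, ζ ω ∂μ := by
  refine ext_inner_right ℝ fun y => ?_
  have h1 := h.inner_const hW y
  rw [IsGaussianWhiteNoise.inner_const_Lp, IsGaussianWhiteNoise.inner_const_Lp] at h1
  rw [h1, integral_congr_ae (Lp.coeFn_const (p := 2) (μ := μ) z₀)]
  simp

/-- The coefficients of a chaos expansion are determined by the inner products with Hermite
functionals. -/
lemma IsChaosExpansion.inner_hermiteLp (hW : IsGaussianWhiteNoise W μ) {ζ : Lp X 2 μ} {z₀ : X}
    {z : (n : ℕ) → symTensorPow X U n} (h : IsChaosExpansion W μ ζ z₀ z) (n : ℕ) (x : X)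
    (u : Metric.sphere (0 : U) 1) :
    ⟪ζ, hW.hermiteLp (n + 1) (u : U) x⟫_ℝ = ⟪(z n : TensorPow X U n), diagTensor n x (u : U)⟫_ℝ := by
  obtain ⟨I, hI, hsum⟩ := h.exists_chaosPair hW
  have hu := norm_eq_of_mem_sphere u
  have h1 := hasSum_inner_left hsum (hW.hermiteLp (n + 1) (u : U) x)
  have h2 := h1.unique (hasSum_single n fun m hm => by
    rw [real_inner_smul_left, (hI m).inner_hermiteLp_of_ne (by simpa using hm) x hu, mul_zero])
  rw [inner_sub_left, real_inner_comm _ (Lp.const 2 μ z₀), inner_hermiteLp_const hW hu,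
    sub_zero] at h2
  rw [h2, real_inner_smul_left, (hI n).inner_hermiteLp, ← mul_assoc, one_div,
    inv_mul_cancel₀ (Nat.cast_ne_zero.2 (Nat.factorial_ne_zero _)), one_mul]

/-- Pairing with Hermite functionals determines the inner products of a coefficient with all unit
diagonal tensors, whose span is dense in the symmetric power. The difference of two coefficients
lies in that space and is orthogonal to it. -/
lemma IsChaosExpansion.unique (hW : IsGaussianWhiteNoise W μ) {ζ : Lp X 2 μ} {z₀ z₀' : X}
    {z z' : (n : ℕ) → symTensorPow X U n} (h : IsChaosExpansion W μ ζ z₀ z)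
    (h' : IsChaosExpansion W μ ζ z₀' z') : z₀' = z₀ ∧ z' = z := by
  refine ⟨(h'.eq_integral hW).trans (h.eq_integral hW).symm, ?_⟩
  funext n
  have horth : (z' n : TensorPow X U n) - z n ∈
      (Submodule.span ℝ (Set.range fun p : X × Metric.sphere (0 : U) 1 =>
        diagTensor n p.1 (p.2 : U)))ᗮ := by
    rw [Submodule.mem_orthogonal']
    intro t ht
    induction ht using Submodule.span_induction with
    | mem t ht =>
      obtain ⟨⟨x, u⟩, rfl⟩ := ht
      rw [inner_sub_left, ← h.inner_hermiteLp hW, ← h'.inner_hermiteLp hW,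
        sub_self]
    | zero => exact inner_zero_right _
    | add s t _ _ hs ht => rw [inner_add_right, hs, ht, add_zero]
    | smul c t _ ht => rw [inner_smul_right, ht, mul_zero]
  rw [← Submodule.orthogonal_closure, ← symTensorPow_eq_closure_span] at horth
  rw [← sub_eq_zero, ← Submodule.coe_eq_zero, ← inner_self_eq_zero (𝕜 := ℝ)]
  exact Submodule.inner_right_of_mem_orthogonal (z' n - z n).2 horth

/-- Parseval's identity for chaos expansions. -/
lemma IsChaosExpansion.hasSum_norm_sq (hW : IsGaussianWhiteNoise W μ) {ζ : Lp X 2 μ} {z₀ : X}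
    {z : (n : ℕ) → symTensorPow X U n} (h : IsChaosExpansion W μ ζ z₀ z) :
    HasSum (fun n => (1 / ((n + 1).factorial : ℝ)) * ‖z n‖ ^ 2) (‖ζ‖ ^ 2 - ‖z₀‖ ^ 2) := by
  obtain ⟨I, hI, hsum⟩ := h.exists_chaosPair hW
  -- By orthogonality only the `n`-th term survives, and `‖I n‖² = (n+1)! ‖z n‖²` cancels its
  -- coefficient.
  have hterm : ∀ n, ⟪I n, ζ - Lp.const 2 μ z₀⟫_ℝ = ‖z n‖ ^ 2 := by
    intro n
    have h2 := (hasSum_inner_left hsum (I n)).unique (hasSum_single n fun m hm => by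
      rw [real_inner_smul_left, (hI m).inner_of_ne (hI n) hm, mul_zero])
    rw [real_inner_comm, h2, real_inner_smul_left, real_inner_self_eq_norm_sq, (hI n).norm_sq,
      ← mul_assoc, one_div, inv_mul_cancel₀ (Nat.cast_ne_zero.2 (Nat.factorial_ne_zero _)),
      one_mul]
    rfl
  have h3 := hasSum_inner_left hsum (ζ - Lp.const 2 μ z₀)
  simp only [real_inner_smul_left, hterm] at h3
  have h4 := h.inner_const hW z₀
  have h5 : ‖Lp.const 2 μ z₀‖ = ‖z₀‖ := by simpa using (isometry_const (μ := μ)).dist_eq z₀ 0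
  convert h3 using 1
  -- Pythagoras: by `h4`, `ζ - z₀` is orthogonal to the constant `z₀`.
  rw [inner_sub_left, inner_sub_right, inner_sub_right, real_inner_comm _ (Lp.const 2 μ z₀), h4,
    sub_self, sub_zero, real_inner_self_eq_norm_sq, real_inner_self_eq_norm_sq, h5]

end Expansion

end WienerChaos

theorem theorem2p3 {Ω : Type*} [MeasurableSpace Ω] (μ : Measure Ω) [IsProbabilityMeasure μ]
    {U : Type*} [NormedAddCommGroup U] [InnerProductSpace ℝ U] [CompleteSpace U]
    [TopologicalSpace.SeparableSpace U]
    {X : Type*} [NormedAddCommGroup X] [InnerProductSpace ℝ X] [CompleteSpace X]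
    [TopologicalSpace.SeparableSpace X]
    (W : U → Ω → ℝ) (hW : WienerChaos.IsGaussianWhiteNoise W μ) (η : Lp X 2 μ) :
    ∃ (η₀ : X) (ηs : (n : ℕ) → WienerChaos.symTensorPow X U n),
      η₀ = ∫ ω, η ω ∂μ ∧
      WienerChaos.IsChaosExpansion W μ η η₀ ηs ∧
      (∀ (ζ₀ : X) (ζs : (n : ℕ) → WienerChaos.symTensorPow X U n),
        WienerChaos.IsChaosExpansion W μ η ζ₀ ζs → ζ₀ = η₀ ∧ ζs = ηs) ∧
      Summable (fun n : ℕ => (1 / ((n + 1).factorial : ℝ)) * ‖ηs n‖ ^ 2) ∧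
      ∫ ω, ‖η ω‖ ^ 2 ∂μ =
        ‖η₀‖ ^ 2 + ∑' n : ℕ, (1 / ((n + 1).factorial : ℝ)) * ‖ηs n‖ ^ 2 := by
  obtain ⟨z₀, z, h⟩ := WienerChaos.exists_isChaosExpansion hW η
  have hsum := h.hasSum_norm_sq hW
  refine ⟨z₀, z, h.eq_integral hW, h, fun ζ₀ ζs h' => h.unique hW h', hsum.summable, ?_⟩
  rw [hsum.tsum_eq, add_sub_cancel, ← real_inner_self_eq_norm_sq, L2.inner_def]
  simp only [real_inner_self_eq_norm_sq]
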